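/- Let $\mathcal S$ be an essentially small triangulated category with shift functor $T$. For full subcategories $\mathcal A,\mathcal B\subset\mathcal S$ let $\mathcal A*\mathcal B$ be the full subcategory of all $x$ that occur in a distinguished triangle $a\to x\to b\to Ta$ with $a\in\mathcal A$ and $b\in\mathcal B$. A *metric* on $\mathcal S$ is a sequence $\{\mathcal M_i\}_{i\in\mathbb N}$ of full additive subcategories of $\mathcal S$ with $\mathcal M_{i+1}\subset\mathcal M_i$ and $\mathcal M_i*\mathcal M_i=\mathcal M_i$ for all $i$. A sequence $E_1\to E_2\to E_3\to\cdots$ in $\mathcal S$ is *Cauchy* if for all $i\in\mathbb N$, $j\in\mathbb Z$ there is an $M>0$ such that, in any distinguished triangle $E_m\to E_{m'}\to D\to TE_m$ with $M\le m<m'$, the object $T^jD$ lies in $\mathcal M_i$. A *Cauchy sequence of triangles* is a sequence of distinguished triangles $A_n\to B_n\to C_n\to TA_n$ and morphisms of triangles between consecutive terms, such that $A_*$, $B_*$ and $C_*$ are Cauchy sequences. Let $\mathrm{Mod}\text{-}\mathcal S$ be the category of additive functors $\mathcal S^{\mathrm{op}}\to\mathrm{Ab}$, with the shift $(TM)(X)=M(T^{-1}X)$,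 and let $Y:\mathcal S\to\mathrm{Mod}\text{-}\mathcal S$, $Y(A)=\mathrm{Hom}(-,A)$, be the Yoneda functor; we identify $Y(TA)$ with $TY(A)$ by the canonical isomorphism. Given a metric $\{\mathcal M_i\}$ on $\mathcal S$, let $\mathfrak L(\mathcal S)\subset\mathrm{Mod}\text{-}\mathcal S$ be the full subcategory of all colimits $\mathrm{colim}\,Y(E_n)$ of Cauchy sequences $E_*$ in $\mathcal S$, and let $\mathfrak S(\mathcal S)\subset\mathfrak L(\mathcal S)$ be the full subcategory of those $X$ such that for every $j\in\mathbb Z$ there is an $i\in\mathbb N$ with $\mathrm{Hom}(Y(T^jm),X)=0$ for all $m\in\mathcal M_i$. **Theorem 205.13.** The subcategory $\mathfrak S(\mathcal S)$ is stable under the shift of $\mathrm{Mod}\text{-}\mathcal S$, and with this shift it is a triangulated category, whose distinguished triangles are exactly the diagrams $A\to B\to C\to TA$ in $\mathfrak S(\mathcal S)$ that are colimits in $\mathrm{Mod}\text{-}\mathcal S$ of (the images under $Y$ of) Cauchy sequences of triangles in $\mathcal S$. -/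

import Mathlib

universe v u

noncomputable section

namespace MetricCompletion

open CategoryTheory Limits Pretriangulated

section ModuleCategory

variable (S : Type u) [Category.{v} S] [Preadditive S]

/-- `Mod-S`: the category of additive functors `Sᵒᵖ ⥤ Ab`. -/
abbrev ModCat := Sᵒᵖ ⥤+ AddCommGrpCat.{v}

/-- The Yoneda functor `Y : S ⥤ Mod-S`, `Y(A) = Hom(-, A)`. -/
def yon : S ⥤ ModCat S :=
  ObjectProperty.lift _ (preadditiveYoneda : S ⥤ Sᵒᵖ ⥤ AddCommGrpCat.{v})
    (fun A => additive_yonedaObj' A)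

end ModuleCategory

section ShiftLemmas

variable {S : Type u} [Category.{v} S] [HasShift S ℤ]

lemma shiftAdd_zero_inv_app (z a : ℤ) (hz : z = 0) (X : S) :
    (shiftFunctorAdd' S a z a (by lia)).inv.app X =
      (shiftFunctorZero' S z hz).hom.app ((shiftFunctor S a).obj X) := by
  subst hz
  simp [shiftFunctorZero', shiftFunctorAdd'_add_zero_inv_app]

lemma shiftZero_add_inv_app (z a : ℤ) (hz : z = 0) (X : S) :
    (shiftFunctorAdd' S z a a (by lia)).inv.app X =
      (shiftFunctor S a).map ((shiftFunctorZero' S z hz).hom.app X) := by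
  subst hz
  simp [shiftFunctorZero', shiftFunctorAdd'_zero_add_inv_app]

end ShiftLemmas

section ModuleShift

variable (S : Type u) [Category.{v} S] [Preadditive S] [HasShift S ℤ]
  [∀ n : ℤ, (shiftFunctor S n).Additive]

/-- The shift by `n` on `Mod-S`: the functor `M ↦ M[n]` with `M[n](X) = M(X[-n])`. -/
def modShift (n : ℤ) : ModCat S ⥤ ModCat S :=
  ObjectProperty.lift _
    (AdditiveFunctor.forget _ _ ⋙ (Functor.whiskeringLeft _ _ _).obj (shiftFunctor S (-n)).op)
    (fun M => by
      change ((shiftFunctor S (-n)).op ⋙ M.obj).Additive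
      infer_instance)

variable {S}

/-- The isomorphism `M[k] ≅ M[n][m]` for `n + m = k`, induced by `X[-m][-n] ≅ X[-k]`. -/
def modShiftAdd (n m k : ℤ) (h : n + m = k) : modShift S k ≅ modShift S n ⋙ modShift S m :=
  NatIso.ofComponents (fun M => ObjectProperty.isoMk _
    (Functor.isoWhiskerRight (NatIso.op
      (shiftFunctorAdd' S (-m) (-n) (-k) (by lia))).symm M.obj))
    (by
      intro M N f
      ext X : 3
      exact (f.hom.naturality _).symm)

/-- The isomorphism `M[0] ≅ M`, induced by `X[-0] = X[0] ≅ X`. -/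
def modShiftZero : modShift S 0 ≅ 𝟭 (ModCat S) :=
  NatIso.ofComponents (fun M => ObjectProperty.isoMk _
    (Functor.isoWhiskerRight (NatIso.op
      (shiftFunctorZero' S (-0 : ℤ) neg_zero)).symm M.obj ≪≫ Functor.leftUnitor _))
    (by
      intro M N f
      ext X : 3
      simp [modShift])

lemma modShiftAdd_hom_app (n m k : ℤ) (h : n + m = k) (M : ModCat S) (X : Sᵒᵖ) :
    ((modShiftAdd n m k h).hom.app M).hom.app X =
      M.obj.map ((shiftFunctorAdd' S (-m) (-n) (-k) (by lia)).inv.app X.unop).op := rfl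

lemma modShiftZero_inv_app (M : ModCat S) (X : Sᵒᵖ) :
    (modShiftZero.inv.app M).hom.app X =
      M.obj.map ((shiftFunctorZero' S (-0 : ℤ) neg_zero).hom.app X.unop).op := by
  simp [modShiftZero]
  rfl

lemma eqToHom_comp_modShiftAdd (n m k : ℤ) (h : n + m = k) (M : ModCat S) :
    eqToHom (by rw [h]) ≫ (modShiftAdd n m (n + m) rfl).hom.app M =
      (modShiftAdd n m k h).hom.app M := by
  subst h
  simp

/-- The coherent system of shift functors on `Mod-S`. -/
def modShiftCore : ShiftMkCore (ModCat S) ℤ where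
  F := modShift S
  zero := modShiftZero
  add n m := modShiftAdd n m _ rfl
  assoc_hom_app a b c M := by
    rw [← Category.assoc, eqToHom_comp_modShiftAdd a (b + c) (a + b + c) (by lia) M]
    ext X : 3
    have := shiftFunctorAdd'_assoc_inv_app (C := S) (-c) (-b) (-a) (-(b + c)) (-(a + b))
      (-(a + b + c)) (by lia) (by lia) (by lia) X.unop
    have := congrArg (fun f => M.obj.map f.op) this
    simp only [op_comp, Functor.map_comp] at this
    exact this.symm
  zero_add_hom_app n M := by
    rw [← cancel_epi (eqToHom
        (by rw [zero_add] : (modShift S n).obj M = (modShift S (0 + n)).obj M)),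
      eqToHom_comp_modShiftAdd 0 n n (zero_add n) M]
    simp only [eqToHom_trans_assoc, eqToHom_refl, Category.id_comp]
    ext X : 3
    rw [modShiftAdd_hom_app]
    refine Eq.trans ?_ (modShiftZero_inv_app M _).symm
    exact congrArg (fun f => M.obj.map f.op) (shiftAdd_zero_inv_app (-0) (-n) neg_zero X.unop)
  add_zero_hom_app n M := by
    rw [← cancel_epi (eqToHom
        (by rw [add_zero] : (modShift S n).obj M = (modShift S (n + 0)).obj M)),
      eqToHom_comp_modShiftAdd n 0 n (add_zero n) M]
    simp only [eqToHom_trans_assoc, eqToHom_refl, Category.id_comp]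
    ext X : 3
    rw [modShiftAdd_hom_app]
    refine Eq.trans ?_ (modShiftZero_inv_app _ _).symm
    exact congrArg (fun f => M.obj.map f.op) (shiftZero_add_inv_app (-0) (-n) neg_zero X.unop)

instance : HasShift (ModCat S) ℤ := hasShiftMk _ _ modShiftCore

instance (n : ℤ) : (shiftFunctor (ModCat S) n).Additive where
  map_add := rfl

variable (S)

/-- The canonical isomorphism `Y(A[1]) ≅ Y(A)[1]`, natural in `A`. At `X` it is the bijection
`Hom(X, A[1]) ≃ Hom(X[-1], A)` of the adjoint equivalence given by `[-1]` and `[1]`,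
which sends `g` to the composite of `g[-1]` with `A[1][-1] ≅ A`. -/
def yonShift : shiftFunctor S (1 : ℤ) ⋙ yon S ≅ yon S ⋙ shiftFunctor (ModCat S) (1 : ℤ) :=
  letI : (shiftEquiv' S (-1 : ℤ) 1 (neg_add_cancel 1)).functor.Additive :=
    inferInstanceAs (shiftFunctor S (-1 : ℤ)).Additive
  NatIso.ofComponents (fun A => ObjectProperty.isoMk _ (NatIso.ofComponents (fun X =>
    (((shiftEquiv' S (-1 : ℤ) 1 (neg_add_cancel 1)).toAdjunction.homAddEquiv
      X.unop A).symm.toAddCommGrpIso))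
    (by
      intro X Z f
      ext g
      exact (shiftEquiv' S (-1 : ℤ) 1
        (neg_add_cancel 1)).toAdjunction.homEquiv_naturality_left_symm f.unop g)))
    (by
      intro A B f
      ext X g
      exact (shiftEquiv' S (-1 : ℤ) 1
        (neg_add_cancel 1)).toAdjunction.homEquiv_naturality_right_symm g f)

lemma yonShift_hom_apply (A X : S) (g : X ⟶ (shiftFunctor S (1 : ℤ)).obj A) :
    (((yonShift S).hom.app A).hom.app (Opposite.op X)).hom g =
      (shiftFunctor S (-1 : ℤ)).map g ≫ (shiftShiftNeg A (1 : ℤ)).hom := rfl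

end ModuleShift

section Metric

variable (S : Type u) [Category.{v} S] [Preadditive S] [HasZeroObject S] [HasShift S ℤ]
  [∀ n : ℤ, (shiftFunctor S n).Additive] [Pretriangulated S]

/-- A metric on a triangulated category `S`: a decreasing sequence of (full) additive
subcategories `M_0 ⊇ M_1 ⊇ ⋯` with `M_i * M_i = M_i`. Here `A * B` (in Mathlib:
`extensionProduct`) consists of the `x` in a triangle `a ⟶ x ⟶ b ⟶ a[1]` with `a ∈ A`, `b ∈ B`. -/
structure TriangulatedMetric where
  /-- the subcategory `M_i` -/
  M : ℕ → ObjectProperty S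
  containsZero : ∀ i, (M i).ContainsZero
  closedUnderSums : ∀ i, (M i).IsClosedUnderBinaryProducts
  anti : ∀ i, M (i + 1) ≤ M i
  star : ∀ i, (M i).extensionProduct (M i) = M i

variable {S}

namespace TriangulatedMetric

variable (m : TriangulatedMetric S)

/-- A sequence `E_0 ⟶ E_1 ⟶ ⋯` is Cauchy if for all `i`, `j` there is `N` such that in any
distinguished triangle `E_p ⟶ E_q ⟶ D ⟶ E_p[1]` with `N ≤ p < q` one has `D[j] ∈ M_i`. -/
def IsCauchy (E : ℕ ⥤ S) : Prop :=
  ∀ (i : ℕ) (j : ℤ), ∃ N : ℕ, ∀ (p q : ℕ) (_ : N ≤ p) (hpq : p < q) (D : S)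
    (g : E.obj q ⟶ D) (δ : D ⟶ (shiftFunctor S (1 : ℤ)).obj (E.obj p)),
    Triangle.mk (E.map (homOfLE hpq.le)) g δ ∈ distTriang S →
      m.M i ((shiftFunctor S j).obj D)

/-- `𝔏(S) ⊆ Mod-S`: the colimits in `Mod-S` of Cauchy sequences in `S`. -/
def colimitsOfCauchy : ObjectProperty (ModCat S) := fun X =>
  ∃ E : ℕ ⥤ S, m.IsCauchy E ∧ ∃ ι : E ⋙ yon S ⟶ (Functor.const ℕ).obj X,
    Nonempty (IsColimit (Cocone.mk X ι))

/-- `[Y(T^j M_i)]^⊥ ⊆ Mod-S`: the `X` with `Hom(Y(a[j]), X) = 0` for all `a ∈ M_i`. -/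
def perp (j : ℤ) (i : ℕ) : ObjectProperty (ModCat S) := fun X =>
  ∀ a : S, m.M i a → ∀ f : (yon S).obj ((shiftFunctor S j).obj a) ⟶ X, f = 0

/-- `𝔖(S) = 𝔏(S) ∩ ⋂_j ⋃_i [Y(T^j M_i)]^⊥`. -/
def completion : ObjectProperty (ModCat S) := fun X =>
  m.colimitsOfCauchy X ∧ ∀ j : ℤ, ∃ i : ℕ, m.perp j i X

/-- A candidate triangle `T` in `Mod-S` is a colimit of a Cauchy sequence of triangles: there is
a sequence `F` of distinguished triangles of `S` whose three sequences of vertices are Cauchy,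
such that the vertices of `T` are the colimits in `Mod-S` of the images under `Y` of these
sequences, and the three morphisms of `T` are the ones induced by those of `F`. -/
def IsColimitOfCauchyTriangles (T : Triangle (ModCat S)) : Prop :=
  ∃ F : ℕ ⥤ Triangle S,
    (∀ n, F.obj n ∈ distTriang S) ∧
    m.IsCauchy (F ⋙ Triangle.π₁) ∧ m.IsCauchy (F ⋙ Triangle.π₂) ∧
    m.IsCauchy (F ⋙ Triangle.π₃) ∧
    ∃ (ι₁ : (F ⋙ Triangle.π₁) ⋙ yon S ⟶ (Functor.const ℕ).obj T.obj₁)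
      (ι₂ : (F ⋙ Triangle.π₂) ⋙ yon S ⟶ (Functor.const ℕ).obj T.obj₂)
      (ι₃ : (F ⋙ Triangle.π₃) ⋙ yon S ⟶ (Functor.const ℕ).obj T.obj₃),
      Nonempty (IsColimit (Cocone.mk T.obj₁ ι₁)) ∧
      Nonempty (IsColimit (Cocone.mk T.obj₂ ι₂)) ∧
      Nonempty (IsColimit (Cocone.mk T.obj₃ ι₃)) ∧
      ∀ n : ℕ,
        ι₁.app n ≫ T.mor₁ = (yon S).map (F.obj n).mor₁ ≫ ι₂.app n ∧
        ι₂.app n ≫ T.mor₂ = (yon S).map (F.obj n).mor₂ ≫ ι₃.app n ∧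
        ι₃.app n ≫ T.mor₃ = (yon S).map (F.obj n).mor₃ ≫
          (yonShift S).hom.app (F.obj n).obj₁ ≫
            (shiftFunctor (ModCat S) (1 : ℤ)).map (ι₁.app n)

end TriangulatedMetric

end Metric

end MetricCompletion

end

/-!
The proof tests everything on morphisms out of representable functors, for which a colimit of a
sequence `E` is transparent: a morphism `Y(Z) ⟶ colim Y(E_n)` factors through a stage, and two
morphisms to a stage that agree in the colimit agree at a later stage (`exists_factor`,
`exists_map_eq`). Hence `𝔏(S)` consists of cohomological functors, and colimits of Cauchy triangles
are exact on representable functors.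

The key point is `TriangulatedMetric.eventually_bijective`. If `Z ∈ 𝔏(S)` is right orthogonal to
`M_i` and `M_i[-1]`, then a morphism of `S` with cone in `M_i` induces a bijection on morphisms to
`Z`. So for a Cauchy sequence `E` with colimit `X` there is an `n`, depending on `i` but not on `Z`,
with `Hom(X, Z) ≅ Hom(Y(E_n), Z)`. As every object of `𝔖(S)` and each of its shifts satisfies the
condition for large `i`, morphisms in `𝔖(S)` are constructed, and identities between them are
checked, at a single stage of the sequence, where the axioms for `S` are available:

* Cones (`exists_isColimitOfCauchyTriangles`). A morphism in `𝔏(S)` comes from a morphism of Cauchy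
  sequences after passage to a subsequence. The cones of its components form a Cauchy sequence,
  provided that the transition maps between them are chosen by means of two octahedra
  (`exists_morphism_trW`). An arbitrary completion to a morphism of triangles need not have a small
  cone.
* Morphisms of triangles (`exists_complete`). A commutative square is restricted to a stage of the
  source, factored through a stage of the target, and completed in `S`.
* Octahedra (`exists_octahedron`). An octahedron in `S` at one stage `n` gives the morphisms between
  the cones and their relations. That the resulting fourth triangle is a colimit of Cauchy
  triangles is not visible at one stage. It is compared with a distinguished triangle on its first
  morphism: the braid lemma shows that it is exact on representable functors, and the five lemma
  that the comparison morphism is an isomorphism (`isIso_of_octahedron`).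
-/

namespace MetricCompletion

open CategoryTheory Limits Pretriangulated Opposite Filter ZeroObject

/-! ### The Yoneda embedding and sequential colimits -/

section YonedaModule

variable {S : Type u} [Category.{v} S] [Preadditive S]

instance : (yon S).Full :=
  Functor.Full.of_comp_faithful_iso ((additiveFunctor Sᵒᵖ AddCommGrpCat.{v}).liftCompιIso
    (preadditiveYoneda : S ⥤ Sᵒᵖ ⥤ AddCommGrpCat.{v}) (fun A => additive_yonedaObj' A))

instance : (yon S).Additive where
  map_add {X Y f g} := by
    ext Z x
    exact Preadditive.comp_add _ _ _ x f g

/-- The additive Yoneda lemma in `Mod-S`. -/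
def yonEquiv (X : S) (M : ModCat S) : ((yon S).obj X ⟶ M) ≃ M.obj.obj (op X) where
  toFun f := (f.hom.app (op X)).hom (𝟙 X)
  invFun x := ObjectProperty.homMk
    { app Z := AddCommGrpCat.ofHom
        { toFun (g : Z.unop ⟶ X) := (M.obj.map g.op).hom x
          map_zero' := congr($(M.obj.map_zero (op X) Z).hom x)
          map_add' g h := congr($(M.obj.map_add (f := g.op) (g := h.op)).hom x) }
      naturality Z W f := by
        ext (g : Z.unop ⟶ X)
        exact congr($(M.obj.map_comp g.op f).hom x) }
  left_inv f := by
    ext Z (g : Z.unop ⟶ X)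
    refine (congr($(f.hom.naturality g.op).hom (𝟙 X))).symm.trans ?_
    exact congrArg (f.hom.app Z).hom (Category.comp_id g)
  right_inv x := by
    change (M.obj.map (𝟙 X).op).hom x = x
    simp

lemma yonEquiv_comp {X : S} {M N : ModCat S} (f : (yon S).obj X ⟶ M) (φ : M ⟶ N) :
    yonEquiv X N (f ≫ φ) = (φ.hom.app (op X)).hom (yonEquiv X M f) := rfl

lemma yonEquiv_symm_comp {X : S} {M N : ModCat S} (x : M.obj.obj (op X)) (φ : M ⟶ N) :
    (yonEquiv X M).symm x ≫ φ = (yonEquiv X N).symm ((φ.hom.app (op X)).hom x) :=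
  (yonEquiv X N).injective (by rw [yonEquiv_comp]; simp)

/-- The representable functors detect isomorphisms in `Mod-S`. -/
lemma isIso_of_yon_bijective {M N : ModCat S} (φ : M ⟶ N)
    (h : ∀ X : S, Function.Bijective fun f : (yon S).obj X ⟶ M => f ≫ φ) : IsIso φ := by
  have (Z : Sᵒᵖ) : IsIso (φ.hom.app Z) := by
    rw [ConcreteCategory.isIso_iff_bijective]
    have : ((φ.hom.app Z) : M.obj.obj Z → N.obj.obj Z) =
        yonEquiv Z.unop N ∘ (fun f => f ≫ φ) ∘ (yonEquiv Z.unop M).symm := by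
      ext x
      simp only [Function.comp, yonEquiv_symm_comp, Equiv.apply_symm_apply]
    rw [this]
    exact (yonEquiv _ _).bijective.comp ((h _).comp (yonEquiv _ _).symm.bijective)
  have : IsIso φ.hom := NatIso.isIso_of_isIso_app _
  have : IsIso ((AdditiveFunctor.forget _ _).map φ) := this
  exact isIso_of_reflects_iso φ (AdditiveFunctor.forget _ _)

instance : (additiveFunctor Sᵒᵖ AddCommGrpCat.{v}).IsClosedUnderIsomorphisms where
  of_iso e h := by
    have : Functor.Additive _ := h
    exact Functor.additive_of_iso e

instance : (additiveFunctor Sᵒᵖ AddCommGrpCat.{v}).IsClosedUnderColimitsOfShape ℕ :=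
  .mk' (by
    rintro _ ⟨F, hF⟩
    have (n : ℕ) : (F.obj n).Additive := hF n
    refine ⟨fun {X Y f g} => ?_⟩
    refine colimit_obj_ext fun n => ?_
    simp only [Preadditive.comp_add, ← NatTrans.naturality, Functor.map_add, Preadditive.add_comp])

end YonedaModule

section SequentialColimits

instance : PreservesColimitsOfShape ℕ (forget AddCommGrpCat.{v}) := by
  -- Mathlib states the preservation for index categories in the universe `v`.
  have : PreservesFilteredColimitsOfSize.{0, 0} (forget AddCommGrpCat.{v}) :=
    preservesFilteredColimitsOfSize_shrink.{0, v, 0, v} _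
  infer_instance

variable {S : Type u} [Category.{v} S] [Preadditive S]

lemma exists_isColimit (E : ℕ ⥤ S) :
    ∃ (X : ModCat S) (ι : E ⋙ yon S ⟶ (Functor.const ℕ).obj X),
      Nonempty (IsColimit (Cocone.mk X ι)) :=
  ⟨_, (colimit.cocone (E ⋙ yon S)).ι, ⟨colimit.isColimit _⟩⟩

variable {E : ℕ ⥤ S} {X : ModCat S} {ι : E ⋙ yon S ⟶ (Functor.const ℕ).obj X}

lemma yon_map_comp_app (ι : E ⋙ yon S ⟶ (Functor.const ℕ).obj X) {p q : ℕ} (f : p ⟶ q) :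
    (yon S).map (E.map f) ≫ ι.app q = ι.app p :=
  (ι.naturality f).trans (Category.comp_id _)

lemma yon_map_comp_app_assoc (ι : E ⋙ yon S ⟶ (Functor.const ℕ).obj X) {p q : ℕ} (f : p ⟶ q)
    {Z : ModCat S} (h : X ⟶ Z) : (yon S).map (E.map f) ≫ ι.app q ≫ h = ι.app p ≫ h :=
  (reassoc_of% (yon_map_comp_app ι f)) h

/-- A morphism from a representable functor to a sequential colimit of representable functors
factors through some stage. -/
lemma exists_factor (hι : IsColimit (Cocone.mk X ι)) {Z : S} (f : (yon S).obj Z ⟶ X) :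
    ∃ (n : ℕ) (g : Z ⟶ E.obj n), (yon S).map g ≫ ι.app n = f := by
  let G : ModCat S ⥤ AddCommGrpCat.{v} := AdditiveFunctor.forget _ _ ⋙ (evaluation _ _).obj (op Z)
  obtain ⟨n, g, hg⟩ := Concrete.isColimit_exists_rep _ (isColimitOfPreserves G hι) (yonEquiv Z X f)
  refine ⟨n, g, (yonEquiv Z X).injective ?_⟩
  refine Eq.trans ?_ hg
  exact congrArg ((ι.app n).hom.app (op Z)).hom (Category.id_comp g)

/-- Two morphisms to a stage of the sequence that agree in the colimit agree at a later stage. -/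
lemma exists_map_eq (hι : IsColimit (Cocone.mk X ι)) {Z : S} {n : ℕ} (g g' : Z ⟶ E.obj n)
    (h : (yon S).map g ≫ ι.app n = (yon S).map g' ≫ ι.app n) :
    ∃ (k : ℕ) (hk : n ≤ k), g ≫ E.map (homOfLE hk) = g' ≫ E.map (homOfLE hk) := by
  let G : ModCat S ⥤ AddCommGrpCat.{v} := AdditiveFunctor.forget _ _ ⋙ (evaluation _ _).obj (op Z)
  have h' := congrArg (yonEquiv Z X) h
  have key (g : Z ⟶ E.obj n) : yonEquiv Z X ((yon S).map g ≫ ι.app n) =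
      ((ι.app n).hom.app (op Z)).hom g :=
    congrArg ((ι.app n).hom.app (op Z)).hom (Category.id_comp g)
  rw [key, key] at h'
  obtain ⟨k, f, f', hk⟩ := Concrete.isColimit_exists_of_rep_eq ((E ⋙ yon S) ⋙ G)
    (isColimitOfPreserves G hι) g g' h'
  obtain rfl := Subsingleton.elim f f'
  exact ⟨k, leOfHom f, hk⟩

lemma exists_map_eq_zero (hι : IsColimit (Cocone.mk X ι)) {Z : S} {n : ℕ} (g : Z ⟶ E.obj n)
    (h : (yon S).map g ≫ ι.app n = 0) :
    ∃ (k : ℕ) (hk : n ≤ k), g ≫ E.map (homOfLE hk) = 0 := by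
  simpa using exists_map_eq hι g 0 (by simpa using h)

/-- A morphism factoring through one stage factors through all later ones. -/
lemma exists_factor_ge (hι : IsColimit (Cocone.mk X ι)) {Z : S} (f : (yon S).obj Z ⟶ X) (m : ℕ) :
    ∃ (n : ℕ) (_ : m ≤ n) (g : Z ⟶ E.obj n), (yon S).map g ≫ ι.app n = f := by
  obtain ⟨n, g, hg⟩ := exists_factor hι f
  refine ⟨max m n, le_max_left _ _, g ≫ E.map (homOfLE (le_max_right _ _)), ?_⟩
  simpa [yon_map_comp_app] using hg

lemma colimit_hom_ext (hι : IsColimit (Cocone.mk X ι)) {Z : ModCat S} {f g : X ⟶ Z}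
    (h : ∀ n, ι.app n ≫ f = ι.app n ≫ g) : f = g :=
  hι.hom_ext h

/-- A strictly increasing sequence of natural numbers is a final functor. -/
lemma final_of_strictMono {φ : ℕ → ℕ} (hφ : StrictMono φ) : hφ.monotone.functor.Final :=
  Functor.final_of_exists_of_isFiltered _ (fun d => ⟨d, ⟨homOfLE (hφ.id_le d)⟩⟩)
    (fun {_ c} _ _ => ⟨c, 𝟙 c, Subsingleton.elim _ _⟩)

/-- Passing to a subsequence does not change the colimit. -/
lemma isColimit_subsequence (hι : IsColimit (Cocone.mk X ι)) {φ : ℕ → ℕ} (hφ : StrictMono φ) :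
    Nonempty (IsColimit (Cocone.mk X
      (Functor.whiskerLeft hφ.monotone.functor ι :
        (hφ.monotone.functor ⋙ E) ⋙ yon S ⟶ (Functor.const ℕ).obj X))) := by
  have := final_of_strictMono hφ
  exact ⟨(Functor.Final.isColimitWhiskerEquiv hφ.monotone.functor (Cocone.mk X ι)).symm hι⟩

end SequentialColimits

/-! ### Shifts of sequential colimits -/

section YonedaShift

variable {S : Type u} [Category.{v} S] [Preadditive S] [HasShift S ℤ]
  [∀ n : ℤ, (shiftFunctor S n).Additive]

variable (S) in
/-- The canonical isomorphism `Y(A[n]) ≅ Y(A)[n]` for an arbitrary integer `n`. -/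
noncomputable def yonShiftBy (n : ℤ) :
    shiftFunctor S n ⋙ yon S ≅ yon S ⋙ shiftFunctor (ModCat S) n :=
  letI : (shiftEquiv' S (-n) n (neg_add_cancel n)).functor.Additive :=
    inferInstanceAs (shiftFunctor S (-n)).Additive
  NatIso.ofComponents (fun A => ObjectProperty.isoMk _ (NatIso.ofComponents (fun X =>
    (((shiftEquiv' S (-n) n (neg_add_cancel n)).toAdjunction.homAddEquiv
      X.unop A).symm.toAddCommGrpIso))
    (by
      intro X Z f
      ext g
      exact (shiftEquiv' S (-n) n
        (neg_add_cancel n)).toAdjunction.homEquiv_naturality_left_symm f.unop g)))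
    (by
      intro A B f
      ext X g
      exact (shiftEquiv' S (-n) n
        (neg_add_cancel n)).toAdjunction.homEquiv_naturality_right_symm g f)

lemma yonShift_naturality_assoc {A B : S} (f : A ⟶ B) {M : ModCat S}
    (h : ((yon S).obj B)⟦(1 : ℤ)⟧ ⟶ M) :
    (yon S).map (f⟦(1 : ℤ)⟧') ≫ (yonShift S).hom.app B ≫ h =
      (yonShift S).hom.app A ≫ ((yon S).map f)⟦(1 : ℤ)⟧' ≫ h :=
  (yonShift S).hom.naturality_assoc f h

variable {E : ℕ ⥤ S} {X : ModCat S}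

/-- The cocone on the shifted sequence `E[n]` with vertex `X[n]` deduced from a cocone on `E`
with vertex `X`, through an identification `e` of the shifts on `S` and on `Mod-S`. -/
noncomputable def shiftCocone {n : ℤ}
    (e : shiftFunctor S n ⋙ yon S ≅ yon S ⋙ shiftFunctor (ModCat S) n)
    (ι : E ⋙ yon S ⟶ (Functor.const ℕ).obj X) :
    (E ⋙ shiftFunctor S n) ⋙ yon S ⟶
      (Functor.const ℕ).obj ((shiftFunctor (ModCat S) n).obj X) where
  app k := e.hom.app (E.obj k) ≫ (shiftFunctor (ModCat S) n).map (ι.app k)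
  naturality p q f := by
    have := e.hom.naturality_assoc (E.map f) ((shiftFunctor (ModCat S) n).map (ι.app q))
    refine this.trans ?_
    refine (congrArg (e.hom.app (E.obj p) ≫ ·)
      ((shiftFunctor (ModCat S) n).map_comp _ _).symm).trans ?_
    rw [yon_map_comp_app]
    exact (Category.comp_id _).symm

/-- The shift of `Mod-S` preserves sequential colimits of representable functors. -/
lemma isColimit_shiftCocone {n : ℤ}
    (e : shiftFunctor S n ⋙ yon S ≅ yon S ⋙ shiftFunctor (ModCat S) n)
    {ι : E ⋙ yon S ⟶ (Functor.const ℕ).obj X} (hι : IsColimit (Cocone.mk X ι)) :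
    Nonempty (IsColimit (Cocone.mk _ (shiftCocone e ι))) :=
  ⟨((IsColimit.precomposeHomEquiv (Functor.isoWhiskerLeft E e) _).symm
    (isColimitOfPreserves (shiftFunctor (ModCat S) n) hι)).ofIsoColimit
      (Cocone.ext (Iso.refl _) (fun _ => Category.comp_id _))⟩

/-- Conversely, a cocone whose shift is a colimit cocone is a colimit cocone. -/
lemma isColimit_of_isColimit_shiftCocone {n : ℤ}
    (e : shiftFunctor S n ⋙ yon S ≅ yon S ⋙ shiftFunctor (ModCat S) n)
    {ι : E ⋙ yon S ⟶ (Functor.const ℕ).obj X}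
    (hι : IsColimit (Cocone.mk _ (shiftCocone e ι))) :
    Nonempty (IsColimit (Cocone.mk X ι)) :=
  ⟨isColimitOfReflects (shiftFunctor (ModCat S) n)
    ((IsColimit.precomposeHomEquiv (Functor.isoWhiskerLeft E e) _)
      (hι.ofIsoColimit (Cocone.ext (Iso.refl _) (fun _ => Category.comp_id _))))⟩

end YonedaShift

/-! ### Cauchy sequences -/

section CauchySequences

variable {S : Type u} [Category.{v} S] [Preadditive S] [HasZeroObject S] [HasShift S ℤ]
  [∀ n : ℤ, (shiftFunctor S n).Additive] [Pretriangulated S]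

/-- If `P` is closed under extensions, the morphisms with cone in `P` are closed under
composition, by the octahedral axiom. -/
lemma trW_comp [IsTriangulated S] {P : ObjectProperty S} [P.IsClosedUnderIsomorphisms]
    [P.IsTriangulatedClosed₂] {X Y Z : S} {f : X ⟶ Y} {g : Y ⟶ Z}
    (hf : P.trW f) (hg : P.trW g) : P.trW (f ≫ g) := by
  obtain ⟨D, a, b, h, hD⟩ := hf
  obtain ⟨D', a', b', h', hD'⟩ := hg
  obtain ⟨D'', a'', b'', h''⟩ := distinguished_cocone_triangle (f ≫ g)
  exact ⟨D'', a'', b'', h'', P.ext_of_isTriangulatedClosed₂ _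
    (Triangulated.someOctahedron rfl h h' h'').mem hD hD'⟩

namespace TriangulatedMetric

variable (m : TriangulatedMetric S)

instance (i : ℕ) : (m.M i).IsClosedUnderIsomorphisms := by
  rw [← m.star i]
  infer_instance

instance (i : ℕ) : (m.M i).IsTriangulatedClosed₂ := .mk' (by
  intro T hT h₁ h₃
  rw [← m.star i]
  exact ⟨_, _, _, _, _, hT, h₁, h₃⟩)

instance (i : ℕ) : (m.M i).ContainsZero := m.containsZero i

/-- The objects `X` such that `X[j] ∈ M_i`. -/
abbrev unshift (i : ℕ) (j : ℤ) : ObjectProperty S := (m.M i).shift j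

instance (i : ℕ) (j : ℤ) : (m.unshift i j).IsTriangulatedClosed₂ := .mk' (by
  intro T hT h₁ h₃
  exact (m.M i).ext_of_isTriangulatedClosed₂ _ (Triangle.shift_distinguished _ hT j) h₁ h₃)

instance (i : ℕ) (j : ℤ) : (m.unshift i j).ContainsZero where
  exists_zero := ⟨_, isZero_zero S, by
    exact (m.M i).prop_of_isZero ((shiftFunctor S j).map_isZero (isZero_zero S))⟩

lemma antitone_M : Antitone m.M := antitone_nat_of_succ_le m.anti

variable {m}

lemma trW_map_refl (E : ℕ ⥤ S) {i : ℕ} {j : ℤ} (p : ℕ) :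
    (m.unshift i j).trW (E.map (homOfLE (le_refl p))) := by
  have h := MorphismProperty.id_mem (m.unshift i j).trW (E.obj p)
  rw [← E.map_id] at h
  exact h

lemma isCauchy_iff {E : ℕ ⥤ S} : m.IsCauchy E ↔
    ∀ (i : ℕ) (j : ℤ), ∃ N : ℕ, ∀ (p q : ℕ) (_ : N ≤ p) (hpq : p ≤ q),
      (m.unshift i j).trW (E.map (homOfLE hpq)) := by
  refine ⟨fun h i j => ?_, fun h i j => ?_⟩
  · obtain ⟨N, hN⟩ := h i j
    refine ⟨N, fun p q hp hpq => ?_⟩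
    obtain rfl | hpq' := hpq.eq_or_lt
    · exact trW_map_refl E p
    · obtain ⟨D, g, δ, hT⟩ := distinguished_cocone_triangle (E.map (homOfLE hpq))
      exact ⟨D, g, δ, hT, hN p q hp hpq' D g δ hT⟩
  · obtain ⟨N, hN⟩ := h i j
    exact ⟨N, fun p q hp hpq D g δ hT =>
      ((m.unshift i j).trW_iff_of_distinguished _ hT).1 (hN p q hp hpq.le)⟩

/-- The Cauchy condition only needs to be checked on consecutive terms. -/
lemma isCauchy_iff_succ [IsTriangulated S] {E : ℕ ⥤ S} : m.IsCauchy E ↔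
    ∀ (i : ℕ) (j : ℤ), ∃ N : ℕ, ∀ (p : ℕ) (_ : N ≤ p),
      (m.unshift i j).trW (E.map (homOfLE p.le_succ)) := by
  rw [isCauchy_iff]
  refine forall₂_congr fun i j => exists_congr fun N =>
    ⟨fun h p hp => h p _ hp _, fun h p q hp hpq => ?_⟩
  induction q, hpq using Nat.le_induction with
  | base => exact trW_map_refl E p
  | succ q hpq ih =>
    rw [← homOfLE_comp hpq q.le_succ, E.map_comp]
    exact trW_comp ih (h q (hp.trans hpq))

lemma IsCauchy.subsequence {E : ℕ ⥤ S} (hE : m.IsCauchy E) {φ : ℕ → ℕ} (hφ : StrictMono φ) :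
    m.IsCauchy (hφ.monotone.functor ⋙ E) := by
  rw [isCauchy_iff] at hE ⊢
  intro i j
  obtain ⟨N, hN⟩ := hE i j
  exact ⟨N, fun p q hp hpq => hN _ _ (hp.trans (hφ.id_le p)) (hφ.monotone hpq)⟩

lemma trW_shift {i : ℕ} {j : ℤ} (n : ℤ) {X Y : S} {f : X ⟶ Y}
    (hf : (m.unshift i (n + j)).trW f) : (m.unshift i j).trW (f⟦n⟧') := by
  obtain ⟨D, g, δ, hT, hD⟩ := hf
  rw [← ObjectProperty.smul_mem_trW_iff _ _ n.negOnePow]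
  exact ⟨_, _, _, Triangle.shift_distinguished _ hT n,
    (m.M i).prop_of_iso ((shiftFunctorAdd S n j).app D) hD⟩

lemma IsCauchy.shift {E : ℕ ⥤ S} (hE : m.IsCauchy E) (n : ℤ) :
    m.IsCauchy (E ⋙ shiftFunctor S n) := by
  rw [isCauchy_iff] at hE ⊢
  intro i j
  obtain ⟨N, hN⟩ := hE i (n + j)
  exact ⟨N, fun p q hp hpq => trW_shift n (hN p q hp hpq)⟩

lemma isCauchy_of_isZero {E : ℕ ⥤ S} (hE : ∀ n, IsZero (E.obj n)) : m.IsCauchy E := by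
  rw [isCauchy_iff]
  intro i j
  refine ⟨0, fun p q _ hpq => ?_⟩
  have : IsIso (E.map (homOfLE hpq)) := ⟨0, (hE p).eq_of_src _ _, (hE q).eq_of_src _ _⟩
  exact ObjectProperty.trW_of_isIso _ _

end TriangulatedMetric

end CauchySequences

/-! ### The completion and its locality -/

namespace TriangulatedMetric

section Completion

variable {S : Type u} [Category.{v} S] [Preadditive S] [HasZeroObject S] [HasShift S ℤ]
  [∀ n : ℤ, (shiftFunctor S n).Additive] [Pretriangulated S] {m : TriangulatedMetric S}

lemma perp_mono {j : ℤ} {i i' : ℕ} (h : i ≤ i') : m.perp j i ≤ m.perp j i' :=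
  fun _ hX a ha => hX a (m.antitone_M h a ha)

lemma perp_shift {j n k : ℤ} (h : j + n = k) {i : ℕ} {X : ModCat S} (hX : m.perp j i X) :
    m.perp k i (X⟦n⟧) := by
  intro a ha f
  let e : ((yon S).obj (a⟦j⟧))⟦n⟧ ≅ (yon S).obj (a⟦k⟧) :=
    ((yonShiftBy S n).app (a⟦j⟧)).symm ≪≫
      (yon S).mapIso ((shiftFunctorAdd' S j n k h).symm.app a)
  obtain ⟨g, hg⟩ := (shiftFunctor (ModCat S) n).map_surjective (e.hom ≫ f)
  rw [hX a ha g, Functor.map_zero] at hg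
  rw [← cancel_epi e.hom, ← hg, comp_zero]

lemma completion_shift {X : ModCat S} (hX : m.completion X) (n : ℤ) : m.completion (X⟦n⟧) := by
  obtain ⟨⟨E, hE, ι, ⟨hι⟩⟩, hX⟩ := hX
  refine ⟨⟨_, hE.shift n, _, isColimit_shiftCocone (yonShiftBy S n) hι⟩, fun j => ?_⟩
  obtain ⟨i, hi⟩ := hX (j - n)
  exact ⟨i, perp_shift (sub_add_cancel j n) hi⟩

instance : m.completion.IsStableUnderShift ℤ where
  isStableUnderShiftBy n := ⟨fun _ hX => completion_shift hX n⟩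

lemma completion_of_isZero {X : ModCat S} (hX : IsZero X) : m.completion X := by
  have h (n : ℕ) : IsZero (((Functor.const ℕ).obj (0 : S) ⋙ yon S).obj n) :=
    (yon S).map_isZero (isZero_zero S)
  refine ⟨⟨(Functor.const ℕ).obj 0, isCauchy_of_isZero (fun _ => isZero_zero S),
    { app n := 0 }, ⟨?_⟩⟩, fun j => ⟨0, fun a _ f => hX.eq_of_tgt _ _⟩⟩
  exact
    { desc s := 0
      fac s n := (h n).eq_of_src _ _
      uniq s f _ := hX.eq_of_src _ _ }

/-- Sequential colimits of representable functors are cohomological functors. -/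
lemma exists_extend {E : ℕ ⥤ S} {X : ModCat S} {ι : E ⋙ yon S ⟶ (Functor.const ℕ).obj X}
    (hι : IsColimit (Cocone.mk X ι)) {T : Triangle S} (hT : T ∈ distTriang S)
    (f : (yon S).obj T.obj₂ ⟶ X) (hf : (yon S).map T.mor₁ ≫ f = 0) :
    ∃ g : (yon S).obj T.obj₃ ⟶ X, (yon S).map T.mor₂ ≫ g = f := by
  obtain ⟨n, f, rfl⟩ := exists_factor hι f
  rw [← Functor.map_comp_assoc] at hf
  obtain ⟨k, hk, h⟩ := exists_map_eq_zero hι _ hf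
  rw [Category.assoc] at h
  obtain ⟨g, hg⟩ := Triangle.yoneda_exact₂ T hT _ h
  refine ⟨(yon S).map g ≫ ι.app k, ?_⟩
  rw [← Functor.map_comp_assoc, ← hg, Functor.map_comp_assoc, yon_map_comp_app]

variable (m) in
/-- The objects of `𝔏(S)` that are right orthogonal to `Y(M_i)` and to `Y(M_i[-1])`. A morphism
`A ⟶ B` of `S` with cone `D ∈ M_i` induces a bijection on morphisms to such an object, because of
the exact sequence of the triangle `D[-1] ⟶ A ⟶ B ⟶ D`. -/
def localAt (i : ℕ) : ObjectProperty (ModCat S) := fun X =>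
  m.colimitsOfCauchy X ∧ m.perp 0 i X ∧ m.perp (-1) i X

lemma eventually_localAt {X : ModCat S} (hX : m.completion X) :
    ∀ᶠ i in atTop, m.localAt i X := by
  obtain ⟨i, hi⟩ := hX.2 0
  obtain ⟨i', hi'⟩ := hX.2 (-1)
  filter_upwards [eventually_ge_atTop i, eventually_ge_atTop i'] with k hk hk'
  exact ⟨hX.1, perp_mono hk _ hi, perp_mono hk' _ hi'⟩

lemma localAt.eq_zero {i : ℕ} {X : ModCat S} (hX : m.localAt i X) {D : S} (hD : m.M i D)
    (f : (yon S).obj D ⟶ X) : f = 0 := by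
  have h := hX.2.1 D hD ((yon S).map ((shiftFunctorZero S ℤ).hom.app D) ≫ f)
  exact (cancel_epi ((yon S).map ((shiftFunctorZero S ℤ).hom.app D))).1 (h.trans comp_zero.symm)

lemma localAt.bijective_of_trW {i : ℕ} {Z : ModCat S} (hZ : m.localAt i Z) {A B : S} {f : A ⟶ B}
    (hf : (m.M i).trW f) :
    Function.Bijective fun g : (yon S).obj B ⟶ Z => (yon S).map f ≫ g := by
  obtain ⟨D, g, δ, hT, hD⟩ := hf
  obtain ⟨E, -, ι, ⟨hι⟩⟩ := hZ.1
  constructor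
  · intro a b hab
    have hab' : (yon S).map f ≫ (a - b) = 0 := by
      rw [Preadditive.comp_sub, sub_eq_zero]
      exact hab
    obtain ⟨c, hc⟩ : ∃ c : (yon S).obj D ⟶ Z, (yon S).map g ≫ c = a - b :=
      exists_extend hι hT (a - b) hab'
    rw [hZ.eq_zero hD c, comp_zero] at hc
    exact sub_eq_zero.1 hc.symm
  · intro a
    exact exists_extend hι (inv_rot_of_distTriang _ hT) a (hZ.2.2 D hD _)

/-- Let `X` be the colimit of a Cauchy sequence. For all `n ≫ 0`, depending only on `i`, the
morphisms from `X` to an object of `𝔏(S)` that is orthogonal to `M_i` and `M_i[-1]` are the same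
as the morphisms from the `n`-th term of the sequence. -/
lemma eventually_bijective {E : ℕ ⥤ S} (hE : m.IsCauchy E) {X : ModCat S}
    {ι : E ⋙ yon S ⟶ (Functor.const ℕ).obj X} (hι : IsColimit (Cocone.mk X ι)) (i : ℕ) :
    ∀ᶠ n in atTop, ∀ ⦃Z : ModCat S⦄, m.localAt i Z →
      Function.Bijective fun f : X ⟶ Z => ι.app n ≫ f := by
  obtain ⟨N, hN⟩ := isCauchy_iff.1 hE i 0
  filter_upwards [eventually_ge_atTop N] with p hp Z hZ
  have hbij (q : ℕ) (hpq : p ≤ q) := hZ.bijective_of_trW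
    (by simpa [unshift] using hN p q hp hpq : (m.M i).trW (E.map (homOfLE hpq)))
  constructor
  · intro f f' hff'
    refine colimit_hom_ext hι fun n => ?_
    have h : ι.app (max n p) ≫ f = ι.app (max n p) ≫ f' := (hbij _ (le_max_right n p)).1 (by
      simpa only [yon_map_comp_app_assoc] using hff')
    rw [← yon_map_comp_app ι (homOfLE (le_max_left n p)), Category.assoc, Category.assoc, h]
  · intro g
    -- The extensions of `g` to the stages `q ≥ p` are unique, hence compatible.
    choose ext hext using fun (q : ℕ) (hpq : p ≤ q) => (hbij q hpq).2 g
    have hext' (q q' : ℕ) (hpq : p ≤ q) (hqq' : q ≤ q') :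
        (yon S).map (E.map (homOfLE hqq')) ≫ ext q' (hpq.trans hqq') = ext q hpq := by
      refine (hbij q hpq).1 ?_
      dsimp only at hext ⊢
      rw [← Functor.map_comp_assoc, ← E.map_comp, homOfLE_comp, hext, hext]
    let s : Cocone (E ⋙ yon S) := Cocone.mk Z
      { app n := (yon S).map (E.map (homOfLE (le_max_left n p))) ≫
          ext (max n p) (le_max_right n p)
        naturality n n' f := by
          have hle := max_le_max_right p (leOfHom f)
          dsimp
          rw [Category.comp_id, ← hext' _ _ (le_max_right n p) hle, ← Functor.map_comp_assoc,
            ← Functor.map_comp_assoc, ← E.map_comp, ← E.map_comp]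
          rfl }
    refine ⟨hι.desc s, (hι.fac s p).trans ?_⟩
    exact hext' p (max p p) le_rfl (le_max_left p p) |>.trans (by
      simpa using hext p le_rfl)

end Completion

end TriangulatedMetric

/-! ### Colimits of Cauchy sequences of triangles -/

section ColimitTriangles

variable {S : Type u} [Category.{v} S] [Preadditive S] [HasShift S ℤ]
  [∀ n : ℤ, (shiftFunctor S n).Additive]

/-- A colimit cocone on `E'[1]` whose vertex is a shift `X[1]` comes from a colimit cocone on `E'`
with vertex `X`. -/
lemma exists_isColimit_of_shift {E E' : ℕ ⥤ S} (α : E' ⋙ shiftFunctor S (1 : ℤ) ≅ E)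
    {X : ModCat S} {ι : E ⋙ yon S ⟶ (Functor.const ℕ).obj (X⟦(1 : ℤ)⟧)}
    (hι : IsColimit (Cocone.mk _ ι)) :
    ∃ ι' : E' ⋙ yon S ⟶ (Functor.const ℕ).obj X, Nonempty (IsColimit (Cocone.mk X ι')) ∧
      ∀ n, (yonShift S).hom.app (E'.obj n) ≫ (ι'.app n)⟦(1 : ℤ)⟧' =
        (yon S).map (α.hom.app n) ≫ ι.app n := by
  let app (n : ℕ) : (yon S).obj (E'.obj n) ⟶ X := (shiftFunctor (ModCat S) (1 : ℤ)).preimage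
    ((yonShift S).inv.app (E'.obj n) ≫ (yon S).map (α.hom.app n) ≫ ι.app n)
  have happ (n : ℕ) : (yonShift S).hom.app (E'.obj n) ≫ (app n)⟦(1 : ℤ)⟧' =
      (yon S).map (α.hom.app n) ≫ ι.app n := by
    simp only [app, Functor.map_preimage]
    exact Iso.hom_inv_id_app_assoc (yonShift S) _ _
  let ι' : E' ⋙ yon S ⟶ (Functor.const ℕ).obj X :=
    { app := app
      naturality p q f := by
        refine (shiftFunctor (ModCat S) (1 : ℤ)).map_injective ?_
        rw [← cancel_epi ((yonShift S).hom.app (E'.obj p))]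
        dsimp
        rw [Category.comp_id, happ, Functor.map_comp, ← yonShift_naturality_assoc, happ,
          ← Functor.map_comp_assoc, ← yon_map_comp_app ι f, ← Functor.map_comp_assoc]
        exact congr((yon S).map $(α.hom.naturality f) ≫ ι.app q) }
  refine ⟨ι', ?_, happ⟩
  refine isColimit_of_isColimit_shiftCocone (yonShift S) (Nonempty.some ⟨?_⟩)
  exact ((IsColimit.precomposeHomEquiv (Functor.isoWhiskerRight α (yon S)) _).symm
    hι).ofIsoColimit (Cocone.ext (Iso.refl _) (fun n => (Category.comp_id _).trans (happ n).symm))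

namespace TriangulatedMetric

variable [HasZeroObject S] [Pretriangulated S] {m : TriangulatedMetric S}

/-- A presentation of a triangle of `Mod-S` as the colimit of a Cauchy sequence of distinguished
triangles of `S`, the sequence being given by its three sequences of vertices `A`, `B`, `C` and
three natural transformations. -/
structure CauchyPresentation (m : TriangulatedMetric S) (T : Triangle (ModCat S)) where
  /-- the sequence of first vertices -/
  A : ℕ ⥤ S
  /-- the sequence of second vertices -/
  B : ℕ ⥤ S
  /-- the sequence of third vertices -/
  C : ℕ ⥤ S
  /-- the first morphisms -/
  u : A ⟶ B
  /-- the second morphisms -/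
  v : B ⟶ C
  /-- the third morphisms -/
  w : C ⟶ A ⋙ shiftFunctor S (1 : ℤ)
  dist (n : ℕ) : Triangle.mk (u.app n) (v.app n) (w.app n) ∈ distTriang S
  isCauchy₁ : m.IsCauchy A
  isCauchy₂ : m.IsCauchy B
  isCauchy₃ : m.IsCauchy C
  /-- the colimit cocone on the first vertices -/
  ι₁ : A ⋙ yon S ⟶ (Functor.const ℕ).obj T.obj₁
  /-- the colimit cocone on the second vertices -/
  ι₂ : B ⋙ yon S ⟶ (Functor.const ℕ).obj T.obj₂
  /-- the colimit cocone on the third vertices -/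
  ι₃ : C ⋙ yon S ⟶ (Functor.const ℕ).obj T.obj₃
  isColimit₁ : Nonempty (IsColimit (Cocone.mk T.obj₁ ι₁))
  isColimit₂ : Nonempty (IsColimit (Cocone.mk T.obj₂ ι₂))
  isColimit₃ : Nonempty (IsColimit (Cocone.mk T.obj₃ ι₃))
  comm₁ (n : ℕ) : ι₁.app n ≫ T.mor₁ = (yon S).map (u.app n) ≫ ι₂.app n
  comm₂ (n : ℕ) : ι₂.app n ≫ T.mor₂ = (yon S).map (v.app n) ≫ ι₃.app n
  comm₃ (n : ℕ) : ι₃.app n ≫ T.mor₃ = (yon S).map (w.app n) ≫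
    (yonShift S).hom.app (A.obj n) ≫ (ι₁.app n)⟦(1 : ℤ)⟧'

/-- A sequence of triangles is the same as three sequences and three natural transformations. -/
lemma isColimitOfCauchyTriangles_iff (T : Triangle (ModCat S)) :
    m.IsColimitOfCauchyTriangles T ↔ Nonempty (m.CauchyPresentation T) := by
  constructor
  · rintro ⟨F, hF, h₁, h₂, h₃, ι₁, ι₂, ι₃, hι₁, hι₂, hι₃, comm⟩
    exact ⟨⟨_, _, _, Functor.whiskerLeft F Triangle.π₁Toπ₂, Functor.whiskerLeft F Triangle.π₂Toπ₃,
      Functor.whiskerLeft F Triangle.π₃Toπ₁, hF, h₁, h₂, h₃, ι₁, ι₂, ι₃, hι₁, hι₂, hι₃,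
      fun n => (comm n).1, fun n => (comm n).2.1, fun n => (comm n).2.2⟩⟩
  · rintro ⟨P⟩
    exact ⟨Triangle.functorMk P.u P.v P.w, P.dist, P.isCauchy₁, P.isCauchy₂, P.isCauchy₃,
      P.ι₁, P.ι₂, P.ι₃, P.isColimit₁, P.isColimit₂, P.isColimit₃,
      fun n => ⟨P.comm₁ n, P.comm₂ n, P.comm₃ n⟩⟩

namespace IsColimitOfCauchyTriangles

variable {T : Triangle (ModCat S)}

lemma of_iso {T' : Triangle (ModCat S)} (hT : m.IsColimitOfCauchyTriangles T) (e : T ≅ T') :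
    m.IsColimitOfCauchyTriangles T' := by
  obtain ⟨P⟩ := (isColimitOfCauchyTriangles_iff T).1 hT
  refine (isColimitOfCauchyTriangles_iff T').2 ⟨⟨P.A, P.B, P.C, P.u, P.v, P.w, P.dist,
    P.isCauchy₁, P.isCauchy₂, P.isCauchy₃, P.ι₁ ≫ (Functor.const ℕ).map e.hom.hom₁,
    P.ι₂ ≫ (Functor.const ℕ).map e.hom.hom₂, P.ι₃ ≫ (Functor.const ℕ).map e.hom.hom₃,
    P.isColimit₁.map
      (fun h => h.ofIsoColimit (Cocone.ext (Triangle.π₁.mapIso e) (fun _ => rfl))),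
    P.isColimit₂.map
      (fun h => h.ofIsoColimit (Cocone.ext (Triangle.π₂.mapIso e) (fun _ => rfl))),
    P.isColimit₃.map
      (fun h => h.ofIsoColimit (Cocone.ext (Triangle.π₃.mapIso e) (fun _ => rfl))),
    fun n => ?_, fun n => ?_, fun n => ?_⟩⟩
  · change (P.ι₁.app n ≫ e.hom.hom₁) ≫ _ = _ ≫ P.ι₂.app n ≫ e.hom.hom₂
    rw [Category.assoc, ← e.hom.comm₁, reassoc_of% (P.comm₁ n)]
  · change (P.ι₂.app n ≫ e.hom.hom₂) ≫ _ = _ ≫ P.ι₃.app n ≫ e.hom.hom₃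
    rw [Category.assoc, ← e.hom.comm₂, reassoc_of% (P.comm₂ n)]
  · change (P.ι₃.app n ≫ e.hom.hom₃) ≫ _ = _ ≫ _ ≫ (P.ι₁.app n ≫ e.hom.hom₁)⟦(1 : ℤ)⟧'
    rw [Category.assoc, ← e.hom.comm₃, reassoc_of% (P.comm₃ n), Functor.map_comp]

lemma rotate (hT : m.IsColimitOfCauchyTriangles T) : m.IsColimitOfCauchyTriangles T.rotate := by
  obtain ⟨P⟩ := (isColimitOfCauchyTriangles_iff T).1 hT
  obtain ⟨hι₁⟩ := P.isColimit₁
  refine (isColimitOfCauchyTriangles_iff _).2 ⟨⟨P.B, P.C, P.A ⋙ shiftFunctor S (1 : ℤ), P.v, P.w,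
    -Functor.whiskerRight P.u _, fun n => rot_of_distTriang _ (P.dist n), P.isCauchy₂,
    P.isCauchy₃, P.isCauchy₁.shift 1, P.ι₂, P.ι₃, shiftCocone (yonShift S) P.ι₁, P.isColimit₂,
    P.isColimit₃, isColimit_shiftCocone (yonShift S) hι₁, P.comm₂, P.comm₃, fun n => ?_⟩⟩
  have h : ((yonShift S).hom.app (P.A.obj n) ≫ (P.ι₁.app n)⟦(1 : ℤ)⟧') ≫ (-T.mor₁⟦(1 : ℤ)⟧') =
      (yon S).map (-(P.u.app n)⟦(1 : ℤ)⟧') ≫ (yonShift S).hom.app (P.B.obj n) ≫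
        (P.ι₂.app n)⟦(1 : ℤ)⟧' := by
    rw [Functor.map_neg, Preadditive.neg_comp, Preadditive.comp_neg, Category.assoc,
      ← Functor.map_comp, P.comm₁, Functor.map_comp, ← yonShift_naturality_assoc]
  exact h

/-- If the rotated triangle is the colimit of triangles `A_n ⟶ B_n ⟶ C_n ⟶ A_n[1]`, the original
one is the colimit of the inversely rotated triangles `C_n[-1] ⟶ A_n ⟶ B_n ⟶ C_n[-1][1]`. -/
lemma of_rotate (hT : m.IsColimitOfCauchyTriangles T.rotate) :
    m.IsColimitOfCauchyTriangles T := by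
  obtain ⟨P⟩ := (isColimitOfCauchyTriangles_iff _).1 hT
  obtain ⟨hι₃⟩ := P.isColimit₃
  let A' : ℕ ⥤ S := P.C ⋙ shiftFunctor S (-1 : ℤ)
  let α : A' ⋙ shiftFunctor S (1 : ℤ) ≅ P.C :=
    Functor.isoWhiskerLeft P.C (shiftEquiv S (1 : ℤ)).counitIso
  obtain ⟨ι₀, hι₀, h⟩ := exists_isColimit_of_shift α hι₃
  let ι₁ : P.A ⋙ yon S ⟶ (Functor.const ℕ).obj T.obj₂ := P.ι₁
  let ι₂ : P.B ⋙ yon S ⟶ (Functor.const ℕ).obj T.obj₃ := P.ι₂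
  let ι₃ : P.C ⋙ yon S ⟶ (Functor.const ℕ).obj (T.obj₁⟦(1 : ℤ)⟧) := P.ι₃
  have comm₂ (n : ℕ) : ι₂.app n ≫ T.mor₃ = (yon S).map (P.v.app n) ≫ ι₃.app n := P.comm₂ n
  have comm₃ (n : ℕ) : ι₃.app n ≫ (-T.mor₁⟦(1 : ℤ)⟧') = (yon S).map (P.w.app n) ≫
      (yonShift S).hom.app (P.A.obj n) ≫ (ι₁.app n)⟦(1 : ℤ)⟧' := P.comm₃ n
  let u : A' ⟶ P.A := -Functor.whiskerRight P.w (shiftFunctor S (-1 : ℤ)) ≫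
    Functor.whiskerLeft P.A (shiftEquiv S (1 : ℤ)).unitIso.inv
  let w : P.B ⟶ A' ⋙ shiftFunctor S (1 : ℤ) := P.v ≫ α.inv
  have hu (n : ℕ) : (u.app n)⟦(1 : ℤ)⟧' = -(α.hom.app n ≫ P.w.app n) := by
    have h₁ : ((P.w.app n)⟦(-1 : ℤ)⟧')⟦(1 : ℤ)⟧' ≫
        (shiftEquiv S (1 : ℤ)).counitIso.hom.app ((P.A.obj n)⟦(1 : ℤ)⟧) =
          α.hom.app n ≫ P.w.app n :=
      (shiftEquiv S (1 : ℤ)).counitIso.hom.naturality (P.w.app n)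
    have h₂ : (shiftEquiv S (1 : ℤ)).counitIso.hom.app ((P.A.obj n)⟦(1 : ℤ)⟧) =
        ((shiftEquiv S (1 : ℤ)).unitIso.inv.app (P.A.obj n))⟦(1 : ℤ)⟧' :=
      (shiftEquiv S (1 : ℤ)).counit_app_functor (P.A.obj n)
    rw [h₂] at h₁
    exact (Functor.map_neg _).trans
      (congrArg Neg.neg (((shiftFunctor S (1 : ℤ)).map_comp _ _).trans h₁))
  refine (isColimitOfCauchyTriangles_iff _).2 ⟨⟨A', P.A, P.B, u, P.u, w,
    fun n => inv_rot_of_distTriang _ (P.dist n), P.isCauchy₃.shift (-1), P.isCauchy₁,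
    P.isCauchy₂, ι₀, ι₁, ι₂, hι₀, P.isColimit₁, P.isColimit₂, fun n => ?_, P.comm₁, fun n => ?_⟩⟩
  · refine (shiftFunctor (ModCat S) (1 : ℤ)).map_injective ?_
    rw [← cancel_epi ((yonShift S).hom.app (A'.obj n)), Functor.map_comp, Functor.map_comp,
      reassoc_of% (h n), ← yonShift_naturality_assoc, hu]
    have := (yon S).map (α.hom.app n) ≫= comm₃ n
    rw [Preadditive.comp_neg, Preadditive.comp_neg, neg_eq_iff_eq_neg] at this
    rw [Functor.map_neg, Preadditive.neg_comp, Functor.map_comp, Category.assoc]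
    exact this
  · rw [comm₂, h]
    simp [w, ← Functor.map_comp_assoc]
    rfl

lemma comp_zero₁₂ (hT : m.IsColimitOfCauchyTriangles T) : T.mor₁ ≫ T.mor₂ = 0 := by
  obtain ⟨P⟩ := (isColimitOfCauchyTriangles_iff T).1 hT
  obtain ⟨hι₁⟩ := P.isColimit₁
  refine colimit_hom_ext hι₁ fun n => ?_
  have h : P.u.app n ≫ P.v.app n = 0 := comp_distTriang_mor_zero₁₂ _ (P.dist n)
  rw [reassoc_of% (P.comm₁ n), P.comm₂, ← Functor.map_comp_assoc, h, Functor.map_zero, zero_comp,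
    comp_zero]

lemma comp_zero₃₁ (hT : m.IsColimitOfCauchyTriangles T) : T.mor₃ ≫ T.mor₁⟦(1 : ℤ)⟧' = 0 := by
  have h : T.mor₃ ≫ (-T.mor₁⟦(1 : ℤ)⟧') = 0 := hT.rotate.rotate.comp_zero₁₂
  rwa [Preadditive.comp_neg, neg_eq_zero] at h

/-- A colimit of Cauchy triangles is exact on representable functors, since filtered colimits of
abelian groups are exact. -/
lemma exact₂ (hT : m.IsColimitOfCauchyTriangles T) {Z : S} (f : (yon S).obj Z ⟶ T.obj₂)
    (hf : f ≫ T.mor₂ = 0) : ∃ g, g ≫ T.mor₁ = f := by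
  obtain ⟨P⟩ := (isColimitOfCauchyTriangles_iff T).1 hT
  obtain ⟨hι₂⟩ := P.isColimit₂
  obtain ⟨hι₃⟩ := P.isColimit₃
  obtain ⟨n, f, rfl⟩ := exists_factor hι₂ f
  rw [Category.assoc, P.comm₂, ← Functor.map_comp_assoc] at hf
  obtain ⟨k, hk, h⟩ := exists_map_eq_zero hι₃ _ hf
  rw [Category.assoc, ← P.v.naturality, ← Category.assoc] at h
  obtain ⟨g, hg⟩ : ∃ g, f ≫ P.B.map (homOfLE hk) = g ≫ P.u.app k :=
    Triangle.coyoneda_exact₂ _ (P.dist k) _ h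
  refine ⟨(yon S).map g ≫ P.ι₁.app k, ?_⟩
  rw [Category.assoc, P.comm₁, ← Functor.map_comp_assoc, ← hg, Functor.map_comp_assoc,
    yon_map_comp_app]

lemma exact₃ (hT : m.IsColimitOfCauchyTriangles T) {Z : S} (f : (yon S).obj Z ⟶ T.obj₃)
    (hf : f ≫ T.mor₃ = 0) : ∃ g, g ≫ T.mor₂ = f :=
  hT.rotate.exact₂ f hf

lemma exact₁ (hT : m.IsColimitOfCauchyTriangles T) {Z : S}
    (f : (yon S).obj Z ⟶ T.obj₁⟦(1 : ℤ)⟧) (hf : f ≫ T.mor₁⟦(1 : ℤ)⟧' = 0) :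
    ∃ g, g ≫ T.mor₃ = f := by
  have h : f ≫ (-T.mor₁⟦(1 : ℤ)⟧') = 0 := by rw [Preadditive.comp_neg, hf, neg_zero]
  exact hT.rotate.rotate.exact₂ f h

lemma exact₂_shift (hT : m.IsColimitOfCauchyTriangles T) {Z : S}
    (f : (yon S).obj Z ⟶ T.obj₂⟦(1 : ℤ)⟧) (hf : f ≫ T.mor₂⟦(1 : ℤ)⟧' = 0) :
    ∃ g, g ≫ T.mor₁⟦(1 : ℤ)⟧' = f := by
  obtain ⟨g, hg⟩ : ∃ g, g ≫ (-T.mor₁⟦(1 : ℤ)⟧') = f := hT.rotate.exact₁ f hf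
  exact ⟨-g, by rw [← hg, Preadditive.comp_neg, Preadditive.neg_comp]⟩

lemma exact₃_shift (hT : m.IsColimitOfCauchyTriangles T) {Z : S}
    (f : (yon S).obj Z ⟶ T.obj₃⟦(1 : ℤ)⟧) (hf : f ≫ T.mor₃⟦(1 : ℤ)⟧' = 0) :
    ∃ g, g ≫ T.mor₂⟦(1 : ℤ)⟧' = f :=
  hT.rotate.exact₂_shift f hf

/-- A commutative square from the first morphism of a distinguished triangle of `S` to that of a
colimit of Cauchy triangles extends to a morphism of triangles, because the square factors
through some term of the sequence. -/
lemma complete_of_distTriang (hT : m.IsColimitOfCauchyTriangles T) {τ : Triangle S}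
    (hτ : τ ∈ distTriang S) (a : (yon S).obj τ.obj₁ ⟶ T.obj₁) (b : (yon S).obj τ.obj₂ ⟶ T.obj₂)
    (hab : (yon S).map τ.mor₁ ≫ b = a ≫ T.mor₁) :
    ∃ c : (yon S).obj τ.obj₃ ⟶ T.obj₃, (yon S).map τ.mor₂ ≫ c = b ≫ T.mor₂ ∧
      c ≫ T.mor₃ = (yon S).map τ.mor₃ ≫ (yonShift S).hom.app τ.obj₁ ≫ a⟦(1 : ℤ)⟧' := by
  obtain ⟨P⟩ := (isColimitOfCauchyTriangles_iff T).1 hT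
  obtain ⟨hι₁⟩ := P.isColimit₁
  obtain ⟨hι₂⟩ := P.isColimit₂
  obtain ⟨n, b, rfl⟩ := exists_factor hι₂ b
  obtain ⟨k, hk, a, rfl⟩ := exists_factor_ge hι₁ a n
  obtain ⟨l, hl, h⟩ : ∃ (l : ℕ) (hl : k ≤ l),
      (τ.mor₁ ≫ b ≫ P.B.map (homOfLE hk)) ≫ P.B.map (homOfLE hl) =
        (a ≫ P.u.app k) ≫ P.B.map (homOfLE hl) := by
    refine exists_map_eq hι₂ _ _ ?_
    rw [Category.assoc, P.comm₁] at hab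
    simpa only [Functor.map_comp, Category.assoc, yon_map_comp_app] using hab
  have h' : τ.mor₁ ≫ (b ≫ P.B.map (homOfLE hk)) ≫ P.B.map (homOfLE hl) =
      (a ≫ P.A.map (homOfLE hl)) ≫ P.u.app l := by
    rw [Category.assoc a, P.u.naturality (homOfLE hl), ← Category.assoc a, ← h]
    simp only [Category.assoc]
  obtain ⟨c, hc₂, hc₃⟩ : ∃ c : τ.obj₃ ⟶ P.C.obj l,
      τ.mor₂ ≫ c = ((b ≫ P.B.map (homOfLE hk)) ≫ P.B.map (homOfLE hl)) ≫ P.v.app l ∧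
        τ.mor₃ ≫ (a ≫ P.A.map (homOfLE hl))⟦(1 : ℤ)⟧' = c ≫ P.w.app l :=
    complete_distinguished_triangle_morphism τ _ hτ (P.dist l) _ _ h'
  refine ⟨(yon S).map c ≫ P.ι₃.app l, ?_, ?_⟩
  · rw [← Functor.map_comp_assoc, hc₂]
    simp only [Functor.map_comp, Category.assoc, ← P.comm₂, yon_map_comp_app_assoc]
  · rw [Category.assoc, P.comm₃, ← Functor.map_comp_assoc, ← hc₃, Functor.map_comp_assoc,
      yonShift_naturality_assoc, ← Functor.map_comp, Functor.map_comp (yon S), Category.assoc,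
      yon_map_comp_app]

lemma perp_obj₃ (hT : m.IsColimitOfCauchyTriangles T) {j : ℤ} {i : ℕ}
    (h₁ : m.perp j i (T.obj₁⟦(1 : ℤ)⟧)) (h₂ : m.perp j i T.obj₂) : m.perp j i T.obj₃ := by
  intro a ha f
  obtain ⟨g, rfl⟩ := hT.exact₃ f (h₁ a ha _)
  rw [h₂ a ha g, zero_comp]

lemma colimitsOfCauchy_obj₃ (hT : m.IsColimitOfCauchyTriangles T) :
    m.colimitsOfCauchy T.obj₃ := by
  obtain ⟨P⟩ := (isColimitOfCauchyTriangles_iff T).1 hT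
  exact ⟨_, P.isCauchy₃, P.ι₃, P.isColimit₃⟩

lemma localAt_obj₃ (hT : m.IsColimitOfCauchyTriangles T) {i : ℕ}
    (h₁ : m.localAt i (T.obj₁⟦(1 : ℤ)⟧)) (h₂ : m.localAt i T.obj₂) : m.localAt i T.obj₃ :=
  ⟨hT.colimitsOfCauchy_obj₃, hT.perp_obj₃ h₁.2.1 h₂.2.1, hT.perp_obj₃ h₁.2.2 h₂.2.2⟩

lemma completion_obj₃ (hT : m.IsColimitOfCauchyTriangles T) (h₁ : m.completion T.obj₁)
    (h₂ : m.completion T.obj₂) : m.completion T.obj₃ := by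
  refine ⟨hT.colimitsOfCauchy_obj₃, fun j => ?_⟩
  obtain ⟨i₁, hi₁⟩ := (completion_shift h₁ 1).2 j
  obtain ⟨i₂, hi₂⟩ := h₂.2 j
  exact ⟨max i₁ i₂, hT.perp_obj₃ (perp_mono (le_max_left _ _) _ hi₁)
    (perp_mono (le_max_right _ _) _ hi₂)⟩

end IsColimitOfCauchyTriangles

end TriangulatedMetric

end ColimitTriangles

/-! ### Cones of morphisms of Cauchy sequences -/

section Straightening

variable {S : Type u} [Category.{v} S] [Preadditive S]

/-- A morphism between colimits of sequences is induced by a morphism from the first sequence to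
a subsequence of the second one. -/
lemma exists_natTrans {A B : ℕ ⥤ S} {X Y : ModCat S}
    {ιA : A ⋙ yon S ⟶ (Functor.const ℕ).obj X} {ιB : B ⋙ yon S ⟶ (Functor.const ℕ).obj Y}
    (hιB : IsColimit (Cocone.mk Y ιB)) (f : X ⟶ Y) :
    ∃ (φ : ℕ → ℕ) (hφ : StrictMono φ) (α : A ⟶ hφ.monotone.functor ⋙ B),
      ∀ n, ιA.app n ≫ f = (yon S).map (α.app n) ≫ ιB.app (φ n) := by
  let Stage (n : ℕ) := Σ k : ℕ,
    { a : A.obj n ⟶ B.obj k // ιA.app n ≫ f = (yon S).map a ≫ ιB.app k }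
  have hzero : Nonempty (Stage 0) := by
    obtain ⟨k, a, ha⟩ := exists_factor hιB (ιA.app 0 ≫ f)
    exact ⟨k, a, ha.symm⟩
  have hsucc (n : ℕ) (s : Stage n) : ∃ (t : Stage (n + 1)) (h : s.1 < t.1),
      A.map (homOfLE n.le_succ) ≫ t.2.1 = s.2.1 ≫ B.map (homOfLE h.le) := by
    obtain ⟨k, a, ha⟩ := s
    obtain ⟨k', hk', a', ha'⟩ := exists_factor_ge hιB (ιA.app (n + 1) ≫ f) (k + 1)
    have hkk' : k ≤ k' := (Nat.le_succ k).trans hk'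
    obtain ⟨l, hl, h⟩ := exists_map_eq hιB (A.map (homOfLE n.le_succ) ≫ a')
      (a ≫ B.map (homOfLE hkk')) (by
        simp only [Functor.map_comp, Category.assoc, ha', yon_map_comp_app,
          yon_map_comp_app_assoc, ha])
    rw [Category.assoc, Category.assoc, ← B.map_comp] at h
    exact ⟨⟨l, a' ≫ B.map (homOfLE hl), by
      rw [Functor.map_comp, Category.assoc, yon_map_comp_app, ha']⟩, hk'.trans hl, h⟩
  -- A stage at `n + 1` is chosen together with an equality in `S`, not only in the colimit.
  choose next hlt hnext using hsucc
  let s (n : ℕ) : Stage n := Nat.rec hzero.some next n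
  have hφ : StrictMono fun n => (s n).1 := strictMono_nat_of_lt_succ fun n => hlt n (s n)
  exact ⟨fun n => (s n).1, hφ, NatTrans.ofSequence (G := hφ.monotone.functor ⋙ B)
    (fun n => (s n).2.1) (fun n => hnext n (s n)), fun n => (s n).2.2⟩

end Straightening

section Cones

variable {S : Type u} [Category.{v} S] [Preadditive S] [HasZeroObject S] [HasShift S ℤ]
  [∀ n : ℤ, (shiftFunctor S n).Additive] [Pretriangulated S] [IsTriangulated S]

/-- A commutative square between the first morphisms of two distinguished triangles extends to a
morphism of triangles whose third component `c` has a cone that is an extension of the shifted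
cone of `a` by the cone of `b`. Here `c` is the composite of the morphisms given by the octahedra
on `A ⟶ B ⟶ B'` and on `A ⟶ A' ⟶ B'`. -/
lemma exists_morphism_trW {A B C A' B' C' : S} {u : A ⟶ B} {v : B ⟶ C} {w : C ⟶ A⟦(1 : ℤ)⟧}
    (hT : Triangle.mk u v w ∈ distTriang S) {u' : A' ⟶ B'} {v' : B' ⟶ C'} {w' : C' ⟶ A'⟦(1 : ℤ)⟧}
    (hT' : Triangle.mk u' v' w' ∈ distTriang S) (a : A ⟶ A') (b : B ⟶ B') (hab : u ≫ b = a ≫ u') :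
    ∃ c : C ⟶ C', v ≫ c = b ≫ v' ∧ w ≫ a⟦(1 : ℤ)⟧' = c ≫ w' ∧
      ∀ (P : ObjectProperty S) [P.IsClosedUnderIsomorphisms] [P.IsTriangulatedClosed₂],
        (P.shift (1 : ℤ)).trW a → P.trW b → P.trW c := by
  obtain ⟨Db, p, q, hb⟩ := distinguished_cocone_triangle b
  obtain ⟨Da, p', q', ha⟩ := distinguished_cocone_triangle a
  obtain ⟨C'', v'', w'', hT''⟩ := distinguished_cocone_triangle (u ≫ b)
  let O := Triangulated.someOctahedron rfl hT hb hT''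
  let O' := Triangulated.someOctahedron hab.symm ha hT' hT''
  refine ⟨O.m₁ ≫ O'.m₃, ?_, ?_, fun P _ _ hPa hPb => trW_comp ?_ ?_⟩
  · rw [O.comm₁_assoc, O'.comm₃]
  · rw [Category.assoc, ← O'.comm₄, O.comm₂_assoc]
  · exact ⟨_, _, _, O.mem, (P.trW_iff_of_distinguished _ hb).1 hPb⟩
  · exact ⟨_, _, _, rot_of_distTriang _ O'.mem,
      ((P.shift (1 : ℤ)).trW_iff_of_distinguished _ ha).1 hPa⟩

namespace TriangulatedMetric

variable {m : TriangulatedMetric S}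

/-- A morphism of Cauchy sequences extends to a Cauchy sequence of distinguished triangles: the
transition maps between the cones are those of `exists_morphism_trW`, so that their own cones lie in
`M_i[-j]` from some index on. -/
lemma exists_cauchy_cone {A B : ℕ ⥤ S} (hA : m.IsCauchy A) (hB : m.IsCauchy B) (α : A ⟶ B) :
    ∃ (C : ℕ ⥤ S) (v : B ⟶ C) (w : C ⟶ A ⋙ shiftFunctor S (1 : ℤ)),
      (∀ n, Triangle.mk (α.app n) (v.app n) (w.app n) ∈ distTriang S) ∧ m.IsCauchy C := by
  choose C v w hT using fun n => distinguished_cocone_triangle (α.app n)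
  choose c hc₂ hc₃ hc using fun n => exists_morphism_trW (hT n) (hT (n + 1))
    (A.map (homOfLE n.le_succ)) (B.map (homOfLE n.le_succ)) (α.naturality _).symm
  refine ⟨Functor.ofSequence c, NatTrans.ofSequence v fun n => ?_,
    NatTrans.ofSequence w fun n => ?_, fun n => ?_, isCauchy_iff_succ.2 fun i j => ?_⟩
  · exact (hc₂ n).symm.trans
      (congrArg (v n ≫ ·) (Functor.ofSequence_map_homOfLE_succ c n).symm)
  · exact (congrArg (· ≫ w (n + 1)) (Functor.ofSequence_map_homOfLE_succ c n)).trans (hc₃ n).symm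
  · exact hT n
  · obtain ⟨N, hN⟩ := isCauchy_iff_succ.1 hA i (1 + j)
    obtain ⟨N', hN'⟩ := isCauchy_iff_succ.1 hB i j
    refine ⟨max N N', fun p hp => ?_⟩
    have h := hc p (m.unshift i j)
      (by simpa only [unshift, ObjectProperty.shift_shift _ _ _ _ rfl] using
        hN p ((le_max_left _ _).trans hp)) (hN' p ((le_max_right _ _).trans hp))
    rwa [← Functor.ofSequence_map_homOfLE_succ c p] at h

/-- The colimit in `Mod-S` of a cone of a morphism of Cauchy sequences. -/
lemma exists_colimit_cone {A B : ℕ ⥤ S} (hA : m.IsCauchy A) (hB : m.IsCauchy B) (α : A ⟶ B)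
    {X Y : ModCat S} (ιA : A ⋙ yon S ⟶ (Functor.const ℕ).obj X)
    {ιB : B ⋙ yon S ⟶ (Functor.const ℕ).obj Y} (hιB : IsColimit (Cocone.mk Y ιB)) :
    ∃ (C : ℕ ⥤ S) (v : B ⟶ C) (w : C ⟶ A ⋙ shiftFunctor S (1 : ℤ)) (Z : ModCat S)
      (ιC : C ⋙ yon S ⟶ (Functor.const ℕ).obj Z) (g : Y ⟶ Z) (h : Z ⟶ X⟦(1 : ℤ)⟧),
      (∀ n, Triangle.mk (α.app n) (v.app n) (w.app n) ∈ distTriang S) ∧ m.IsCauchy C ∧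
      Nonempty (IsColimit (Cocone.mk Z ιC)) ∧
      (∀ n, ιB.app n ≫ g = (yon S).map (v.app n) ≫ ιC.app n) ∧
      (∀ n, ιC.app n ≫ h = (yon S).map (w.app n) ≫
        (yonShift S).hom.app (A.obj n) ≫ (ιA.app n)⟦(1 : ℤ)⟧') := by
  obtain ⟨C, v, w, hT, hC⟩ := exists_cauchy_cone hA hB α
  obtain ⟨Z, ιC, ⟨hιC⟩⟩ := exists_isColimit C
  exact ⟨C, v, w, Z, ιC,
    hιB.desc (Cocone.mk Z (Functor.whiskerRight v (yon S) ≫ ιC)),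
    hιC.desc (Cocone.mk _ (Functor.whiskerRight w (yon S) ≫ shiftCocone (yonShift S) ιA)),
    hT, hC, ⟨hιC⟩, fun n => hιB.fac _ n, fun n => hιC.fac _ n⟩

/-- Every morphism of `𝔏(S)` is the first morphism of a colimit of Cauchy triangles. -/
lemma exists_isColimitOfCauchyTriangles {X Y : ModCat S} (hX : m.colimitsOfCauchy X)
    (hY : m.colimitsOfCauchy Y) (f : X ⟶ Y) :
    ∃ (Z : ModCat S) (g : Y ⟶ Z) (h : Z ⟶ X⟦(1 : ℤ)⟧),
      m.IsColimitOfCauchyTriangles (Triangle.mk f g h) := by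
  obtain ⟨A, hA, ιA, hιA⟩ := hX
  obtain ⟨B, hB, ιB, ⟨hιB⟩⟩ := hY
  obtain ⟨φ, hφ, α, hα⟩ := exists_natTrans (ιA := ιA) hιB f
  obtain ⟨hιB'⟩ := isColimit_subsequence hιB hφ
  obtain ⟨C, v, w, Z, ιC, g, h, hT, hC, hιC, hg, hh⟩ :=
    exists_colimit_cone hA (hB.subsequence hφ) α ιA hιB'
  exact ⟨Z, g, h, (isColimitOfCauchyTriangles_iff _).2 ⟨⟨_, _, _, α, v, w, hT, hA,
    hB.subsequence hφ, hC, ιA, _, ιC, hιA, ⟨hιB'⟩, hιC, hα, hg, hh⟩⟩⟩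

end TriangulatedMetric

end Cones

/-! ### The axioms in `Mod-S` -/

namespace TriangulatedMetric

section Axioms

variable {S : Type u} [Category.{v} S] [Preadditive S] [HasZeroObject S] [HasShift S ℤ]
  [∀ n : ℤ, (shiftFunctor S n).Additive] [Pretriangulated S] {m : TriangulatedMetric S}

lemma isColimitOfCauchyTriangles_contractible {X Z : ModCat S} (hX : m.colimitsOfCauchy X)
    (hZ : IsZero Z) : m.IsColimitOfCauchyTriangles (Triangle.mk (𝟙 X) (0 : X ⟶ Z) 0) := by
  obtain ⟨E, hE, ι, hι⟩ := hX
  have h (n : ℕ) : IsZero (((Functor.const ℕ).obj (0 : S) ⋙ yon S).obj n) :=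
    (yon S).map_isZero (isZero_zero S)
  refine (isColimitOfCauchyTriangles_iff _).2 ⟨⟨E, E, (Functor.const ℕ).obj 0, 𝟙 E,
    { app n := 0 }, { app n := 0 }, fun n => contractible_distinguished (E.obj n), hE, hE,
    isCauchy_of_isZero (fun _ => isZero_zero S), ι, ι, { app n := 0 }, hι, hι, ⟨?_⟩,
    fun n => ?_, fun n => hZ.eq_of_tgt _ _, fun n => (h n).eq_of_src _ _⟩⟩
  · exact
      { desc s := 0
        fac s n := (h n).eq_of_src _ _
        uniq s f _ := hZ.eq_of_src _ _ }
  · exact (Category.comp_id (ι.app n)).trans (by simp)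

/-- A commutative square between the first morphisms of two triangles extends to a morphism of
triangles: it suffices to extend the restriction of the square to a term of the first Cauchy
sequence that is far enough. -/
lemma exists_complete {T T' : Triangle (ModCat S)} (hT : m.IsColimitOfCauchyTriangles T)
    (hT' : m.IsColimitOfCauchyTriangles T') (h₁ : m.completion T'.obj₁)
    (h₂ : m.completion T'.obj₂) (a : T.obj₁ ⟶ T'.obj₁) (b : T.obj₂ ⟶ T'.obj₂)
    (hab : T.mor₁ ≫ b = a ≫ T'.mor₁) :
    ∃ c : T.obj₃ ⟶ T'.obj₃, T.mor₂ ≫ c = b ≫ T'.mor₂ ∧ T.mor₃ ≫ a⟦(1 : ℤ)⟧' = c ≫ T'.mor₃ := by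
  obtain ⟨i, hi₃, hi₁⟩ := ((eventually_localAt (hT'.completion_obj₃ h₁ h₂)).and
    (eventually_localAt (completion_shift h₁ 1))).exists
  obtain ⟨P⟩ := (isColimitOfCauchyTriangles_iff T).1 hT
  obtain ⟨hι₂⟩ := P.isColimit₂
  obtain ⟨hι₃⟩ := P.isColimit₃
  obtain ⟨n, hB, hC⟩ := ((eventually_bijective P.isCauchy₂ hι₂ i).and
    (eventually_bijective P.isCauchy₃ hι₃ i)).exists
  obtain ⟨c', hc₂, hc₃⟩ : ∃ c' : (yon S).obj (P.C.obj n) ⟶ T'.obj₃,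
      (yon S).map (P.v.app n) ≫ c' = (P.ι₂.app n ≫ b) ≫ T'.mor₂ ∧
        c' ≫ T'.mor₃ = (yon S).map (P.w.app n) ≫ (yonShift S).hom.app (P.A.obj n) ≫
          (P.ι₁.app n ≫ a)⟦(1 : ℤ)⟧' :=
    hT'.complete_of_distTriang (P.dist n) (P.ι₁.app n ≫ a) (P.ι₂.app n ≫ b) (by
      change (yon S).map (P.u.app n) ≫ P.ι₂.app n ≫ b = (P.ι₁.app n ≫ a) ≫ T'.mor₁
      rw [Category.assoc, ← hab, reassoc_of% (P.comm₁ n)])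
  obtain ⟨c, hc : P.ι₃.app n ≫ c = c'⟩ := (hC hi₃).2 c'
  refine ⟨c, (hB hi₃).1 ?_, (hC hi₁).1 ?_⟩
  · change P.ι₂.app n ≫ T.mor₂ ≫ c = P.ι₂.app n ≫ b ≫ T'.mor₂
    rw [reassoc_of% (P.comm₂ n), hc, hc₂, Category.assoc]
  · change P.ι₃.app n ≫ T.mor₃ ≫ a⟦(1 : ℤ)⟧' = P.ι₃.app n ≫ c ≫ T'.mor₃
    rw [reassoc_of% (P.comm₃ n), reassoc_of% hc, hc₃, Functor.map_comp]

/-- In an octahedron in which all the commutation relations hold, three of the four triangles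
are colimits of Cauchy triangles and the fourth one is a complex, the fourth one is exact on
representable functors (the braid lemma). Hence, by the five lemma, its third vertex is isomorphic
to any other cone of its first morphism with which it can be compared. -/
lemma isIso_of_octahedron {X Y Z D E F F' : ModCat S} {f : X ⟶ Y} {g : Y ⟶ Z}
    {v₁₂ : Y ⟶ D} {w₁₂ : D ⟶ X⟦(1 : ℤ)⟧} {v₂₃ : Z ⟶ F} {w₂₃ : F ⟶ Y⟦(1 : ℤ)⟧}
    {v₁₃ : Z ⟶ E} {w₁₃ : E ⟶ X⟦(1 : ℤ)⟧} {m₁ : D ⟶ E} {m₃ : E ⟶ F}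
    {v' : E ⟶ F'} {w' : F' ⟶ D⟦(1 : ℤ)⟧}
    (h₁₂ : m.IsColimitOfCauchyTriangles (Triangle.mk f v₁₂ w₁₂))
    (h₂₃ : m.IsColimitOfCauchyTriangles (Triangle.mk g v₂₃ w₂₃))
    (h₁₃ : m.IsColimitOfCauchyTriangles (Triangle.mk (f ≫ g) v₁₃ w₁₃))
    (h' : m.IsColimitOfCauchyTriangles (Triangle.mk m₁ v' w'))
    (comm₁ : v₁₂ ≫ m₁ = g ≫ v₁₃) (comm₂ : m₁ ≫ w₁₃ = w₁₂) (comm₃ : v₁₃ ≫ m₃ = v₂₃)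
    (comm₄ : w₁₃ ≫ f⟦(1 : ℤ)⟧' = m₃ ≫ w₂₃) (zero : m₁ ≫ m₃ = 0)
    {φ : F ⟶ F'} (hφ₂ : m₃ ≫ φ = v') (hφ₃ : φ ≫ w' = w₂₃ ≫ v₁₂⟦(1 : ℤ)⟧') : IsIso φ := by
  have comm₁' := congrArg (fun t => t⟦(1 : ℤ)⟧') comm₁
  have comm₂' := congrArg (fun t => t⟦(1 : ℤ)⟧') comm₂
  simp only [Functor.map_comp] at comm₁' comm₂'
  have z₁₂ : f⟦(1 : ℤ)⟧' ≫ v₁₂⟦(1 : ℤ)⟧' = 0 := by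
    have h : f ≫ v₁₂ = 0 := h₁₂.comp_zero₁₂
    rw [← Functor.map_comp, h, Functor.map_zero]
  have z₂₃ : w₂₃ ≫ g⟦(1 : ℤ)⟧' = 0 := h₂₃.comp_zero₃₁
  have z₁₃ : w₁₃ ≫ (f ≫ g)⟦(1 : ℤ)⟧' = 0 := h₁₃.comp_zero₃₁
  have z' : w' ≫ m₁⟦(1 : ℤ)⟧' = 0 := h'.comp_zero₃₁
  -- Exactness of the fourth triangle at `F`, then at `D[1]`.
  have ex₁ {W : S} (x : (yon S).obj W ⟶ F) (hx : x ≫ w₂₃ ≫ v₁₂⟦(1 : ℤ)⟧' = 0) :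
      ∃ y, y ≫ m₃ = x := by
    obtain ⟨a, ha⟩ : ∃ a, a ≫ f⟦(1 : ℤ)⟧' = x ≫ w₂₃ :=
      h₁₂.exact₂_shift (x ≫ w₂₃) ((Category.assoc _ _ _).trans hx)
    have h : a ≫ (f ≫ g)⟦(1 : ℤ)⟧' = 0 := by
      rw [Functor.map_comp, reassoc_of% ha, z₂₃, comp_zero]
    obtain ⟨e, he⟩ : ∃ e, e ≫ w₁₃ = a := h₁₃.exact₁ a h
    have h : (x - e ≫ m₃) ≫ w₂₃ = 0 := by
      rw [Preadditive.sub_comp, Category.assoc, ← comm₄, reassoc_of% he, ha, sub_self]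
    obtain ⟨c, hc⟩ : ∃ c, c ≫ v₂₃ = x - e ≫ m₃ := h₂₃.exact₃ _ h
    exact ⟨e + c ≫ v₁₃, by rw [Preadditive.add_comp, Category.assoc, comm₃, hc, add_sub_cancel]⟩
  have ex₂ {W : S} (y : (yon S).obj W ⟶ D⟦(1 : ℤ)⟧) (hy : y ≫ m₁⟦(1 : ℤ)⟧' = 0) :
      ∃ x, x ≫ w₂₃ ≫ v₁₂⟦(1 : ℤ)⟧' = y := by
    obtain ⟨b, hb⟩ : ∃ b, b ≫ v₁₂⟦(1 : ℤ)⟧' = y := h₁₂.exact₃_shift y (by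
      change y ≫ w₁₂⟦(1 : ℤ)⟧' = 0
      rw [← comm₂', reassoc_of% hy, zero_comp])
    have h : (b ≫ g⟦(1 : ℤ)⟧') ≫ v₁₃⟦(1 : ℤ)⟧' = 0 := by
      rw [Category.assoc, ← comm₁', reassoc_of% hb, hy]
    obtain ⟨a, ha⟩ : ∃ a, a ≫ (f ≫ g)⟦(1 : ℤ)⟧' = b ≫ g⟦(1 : ℤ)⟧' := h₁₃.exact₂_shift _ h
    have h : (b - a ≫ f⟦(1 : ℤ)⟧') ≫ g⟦(1 : ℤ)⟧' = 0 := by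
      rw [Preadditive.sub_comp, Category.assoc, ← Functor.map_comp, ha, sub_self]
    obtain ⟨x, hx⟩ : ∃ x, x ≫ w₂₃ = b - a ≫ f⟦(1 : ℤ)⟧' := h₂₃.exact₁ _ h
    refine ⟨x, ?_⟩
    rw [reassoc_of% hx, Preadditive.sub_comp, hb, Category.assoc, z₁₂, comp_zero, sub_zero]
  refine isIso_of_yon_bijective φ fun W => ⟨fun x x' hxx' => ?_, fun x' => ?_⟩
  · have h : (x - x') ≫ φ = 0 := by rw [Preadditive.sub_comp, sub_eq_zero]; exact hxx'
    obtain ⟨y, hy⟩ := ex₁ (x - x') (by rw [← hφ₃, reassoc_of% h, zero_comp])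
    obtain ⟨z, rfl⟩ : ∃ z, z ≫ m₁ = y := h'.exact₂ y (by
      change y ≫ v' = 0
      rw [← hφ₂, reassoc_of% hy, h])
    rw [Category.assoc, zero, comp_zero] at hy
    exact sub_eq_zero.1 hy.symm
  · obtain ⟨x, hx⟩ := ex₂ (x' ≫ w') (by rw [Category.assoc, z', comp_zero])
    obtain ⟨y, hy⟩ : ∃ y, y ≫ v' = x' - x ≫ φ := h'.exact₃ (x' - x ≫ φ) (by
      change (x' - x ≫ φ) ≫ w' = 0
      rw [Preadditive.sub_comp, Category.assoc, hφ₃, hx, sub_self])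
    refine ⟨x + y ≫ m₃, ?_⟩
    change (x + y ≫ m₃) ≫ φ = x'
    rw [Preadditive.add_comp, Category.assoc, hφ₂, hy, add_sub_cancel]

/-- The octahedral axiom for `𝔖(S)`: the octahedron of `S` at a stage `n ≫ 0` extends uniquely to
the colimits, and its fourth triangle is recognized by `isIso_of_octahedron`. -/
lemma exists_octahedron [IsTriangulated S] {X Y Z : ModCat S} (hX : m.completion X)
    (hY : m.completion Y) (hZ : m.completion Z) (f : X ⟶ Y) (g : Y ⟶ Z) :
    ∃ (D E F : ModCat S) (v₁₂ : Y ⟶ D) (w₁₂ : D ⟶ X⟦(1 : ℤ)⟧) (v₂₃ : Z ⟶ F) (w₂₃ : F ⟶ Y⟦(1 : ℤ)⟧)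
      (v₁₃ : Z ⟶ E) (w₁₃ : E ⟶ X⟦(1 : ℤ)⟧) (m₁ : D ⟶ E) (m₃ : E ⟶ F),
      m.IsColimitOfCauchyTriangles (Triangle.mk f v₁₂ w₁₂) ∧
      m.IsColimitOfCauchyTriangles (Triangle.mk g v₂₃ w₂₃) ∧
      m.IsColimitOfCauchyTriangles (Triangle.mk (f ≫ g) v₁₃ w₁₃) ∧
      v₁₂ ≫ m₁ = g ≫ v₁₃ ∧ m₁ ≫ w₁₃ = w₁₂ ∧ v₁₃ ≫ m₃ = v₂₃ ∧ w₁₃ ≫ f⟦(1 : ℤ)⟧' = m₃ ≫ w₂₃ ∧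
      m.IsColimitOfCauchyTriangles (Triangle.mk m₁ m₃ (w₂₃ ≫ v₁₂⟦(1 : ℤ)⟧')) := by
  obtain ⟨A, hA, ιA, ⟨hιA⟩⟩ := hX.1
  obtain ⟨B, hB, ιB, hιB, α, hα⟩ : ∃ (B : ℕ ⥤ S) (_ : m.IsCauchy B)
      (ιB : B ⋙ yon S ⟶ (Functor.const ℕ).obj Y) (_ : IsColimit (Cocone.mk Y ιB)) (α : A ⟶ B),
      ∀ n, ιA.app n ≫ f = (yon S).map (α.app n) ≫ ιB.app n := by
    obtain ⟨B, hB, ιB, ⟨hιB⟩⟩ := hY.1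
    obtain ⟨φ, hφ, α, hα⟩ := exists_natTrans (ιA := ιA) hιB f
    exact ⟨_, hB.subsequence hφ, _, (isColimit_subsequence hιB hφ).some, α, hα⟩
  obtain ⟨C, hC, ιC, hιC, β, hβ⟩ : ∃ (C : ℕ ⥤ S) (_ : m.IsCauchy C)
      (ιC : C ⋙ yon S ⟶ (Functor.const ℕ).obj Z) (_ : IsColimit (Cocone.mk Z ιC)) (β : B ⟶ C),
      ∀ n, ιB.app n ≫ g = (yon S).map (β.app n) ≫ ιC.app n := by
    obtain ⟨C, hC, ιC, ⟨hιC⟩⟩ := hZ.1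
    obtain ⟨φ, hφ, β, hβ⟩ := exists_natTrans (ιA := ιB) hιC g
    exact ⟨_, hC.subsequence hφ, _, (isColimit_subsequence hιC hφ).some, β, hβ⟩
  have hαβ (n : ℕ) : ιA.app n ≫ f ≫ g = (yon S).map ((α ≫ β).app n) ≫ ιC.app n := by
    rw [reassoc_of% hα, hβ, NatTrans.comp_app, Functor.map_comp_assoc]
  obtain ⟨sD, v₁, w₁, D, ιD, v₁₂, w₁₂, hT₁₂, hD, hιD, hv₁₂, hw₁₂⟩ :=
    exists_colimit_cone hA hB α ιA hιB
  obtain ⟨sF, v₂, w₂, F, ιF, v₂₃, w₂₃, hT₂₃, hF, hιF, hv₂₃, hw₂₃⟩ :=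
    exists_colimit_cone hB hC β ιB hιC
  obtain ⟨sE, v₃, w₃, E, ιE, v₁₃, w₁₃, hT₁₃, hE, hιE, hv₁₃, hw₁₃⟩ :=
    exists_colimit_cone hA hC (α ≫ β) ιA hιC
  have h₁₂ : m.IsColimitOfCauchyTriangles (Triangle.mk f v₁₂ w₁₂) :=
    (isColimitOfCauchyTriangles_iff _).2 ⟨⟨A, B, sD, α, v₁, w₁, hT₁₂, hA, hB, hD, ιA, ιB, ιD,
      ⟨hιA⟩, ⟨hιB⟩, hιD, hα, hv₁₂, hw₁₂⟩⟩
  have h₂₃ : m.IsColimitOfCauchyTriangles (Triangle.mk g v₂₃ w₂₃) :=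
    (isColimitOfCauchyTriangles_iff _).2 ⟨⟨B, C, sF, β, v₂, w₂, hT₂₃, hB, hC, hF, ιB, ιC, ιF,
      ⟨hιB⟩, ⟨hιC⟩, hιF, hβ, hv₂₃, hw₂₃⟩⟩
  have h₁₃ : m.IsColimitOfCauchyTriangles (Triangle.mk (f ≫ g) v₁₃ w₁₃) :=
    (isColimitOfCauchyTriangles_iff _).2 ⟨⟨A, C, sE, α ≫ β, v₃, w₃, hT₁₃, hA, hC, hE, ιA, ιC, ιE,
      ⟨hιA⟩, ⟨hιC⟩, hιE, hαβ, hv₁₃, hw₁₃⟩⟩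
  obtain ⟨hιD⟩ := hιD
  obtain ⟨hιE⟩ := hιE
  obtain ⟨hιF⟩ := hιF
  have hcD : m.completion D := h₁₂.completion_obj₃ hX hY
  have hcE : m.completion E := h₁₃.completion_obj₃ hX hZ
  have hcF : m.completion F := h₂₃.completion_obj₃ hY hZ
  obtain ⟨i, lE, lF, lX, lY, lD⟩ := ((eventually_localAt hcE).and <|
    (eventually_localAt hcF).and <| (eventually_localAt (completion_shift hX 1)).and <|
    (eventually_localAt (completion_shift hY 1)).and <|
    eventually_localAt (completion_shift hcD 1)).exists
  -- The cone of `m₁` is local for the same `i` as `E` and `D[1]`, so that the index `n` can be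
  -- chosen before `m₁` is constructed.
  obtain ⟨n, bB, bC, bD, bE, bF⟩ := ((eventually_bijective hB hιB i).and <|
    (eventually_bijective hC hιC i).and <| (eventually_bijective hD hιD i).and <|
    (eventually_bijective hE hιE i).and <| eventually_bijective hF hιF i).exists
  let O := Triangulated.someOctahedron rfl (hT₁₂ n) (hT₂₃ n) (hT₁₃ n)
  let o₁ : sD.obj n ⟶ sE.obj n := O.m₁
  let o₃ : sE.obj n ⟶ sF.obj n := O.m₃
  have c₁ : v₁.app n ≫ o₁ = β.app n ≫ v₃.app n := O.comm₁
  have c₂ : o₁ ≫ w₃.app n = w₁.app n := O.comm₂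
  have c₃ : v₃.app n ≫ o₃ = v₂.app n := O.comm₃
  have c₄ : w₃.app n ≫ (α.app n)⟦(1 : ℤ)⟧' = o₃ ≫ w₂.app n := O.comm₄
  have mem : Triangle.mk o₁ o₃ (w₂.app n ≫ (v₁.app n)⟦(1 : ℤ)⟧') ∈ distTriang S := O.mem
  obtain ⟨m₁, hm₁ : ιD.app n ≫ m₁ = _⟩ := (bD lE).2 ((yon S).map o₁ ≫ ιE.app n)
  obtain ⟨m₃, hm₃ : ιE.app n ≫ m₃ = _⟩ := (bE lF).2 ((yon S).map o₃ ≫ ιF.app n)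
  have comm₁ : v₁₂ ≫ m₁ = g ≫ v₁₃ := (bB lE).1 (by
    change ιB.app n ≫ v₁₂ ≫ m₁ = ιB.app n ≫ g ≫ v₁₃
    rw [reassoc_of% (hv₁₂ n), hm₁, reassoc_of% (hβ n), hv₁₃, ← Functor.map_comp_assoc, c₁,
      Functor.map_comp_assoc])
  have comm₂ : m₁ ≫ w₁₃ = w₁₂ := (bD lX).1 (by
    change ιD.app n ≫ m₁ ≫ w₁₃ = ιD.app n ≫ w₁₂
    rw [reassoc_of% hm₁, hw₁₃, hw₁₂, ← Functor.map_comp_assoc, c₂])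
  have comm₃ : v₁₃ ≫ m₃ = v₂₃ := (bC lF).1 (by
    change ιC.app n ≫ v₁₃ ≫ m₃ = ιC.app n ≫ v₂₃
    rw [reassoc_of% (hv₁₃ n), hm₃, hv₂₃, ← Functor.map_comp_assoc, c₃])
  have comm₄ : w₁₃ ≫ f⟦(1 : ℤ)⟧' = m₃ ≫ w₂₃ := (bE lY).1 (by
    change ιE.app n ≫ w₁₃ ≫ f⟦(1 : ℤ)⟧' = ιE.app n ≫ m₃ ≫ w₂₃
    rw [reassoc_of% (hw₁₃ n), reassoc_of% hm₃, hw₂₃, ← Functor.map_comp, hα, Functor.map_comp,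
      ← yonShift_naturality_assoc, ← Functor.map_comp_assoc, c₄, Functor.map_comp_assoc])
  have zero : m₁ ≫ m₃ = 0 := (bD lF).1 (by
    change ιD.app n ≫ m₁ ≫ m₃ = ιD.app n ≫ 0
    have h : o₁ ≫ o₃ = 0 := comp_distTriang_mor_zero₁₂ _ mem
    rw [reassoc_of% hm₁, hm₃, ← Functor.map_comp_assoc, h, Functor.map_zero, zero_comp, comp_zero])
  obtain ⟨F', v', w', h'⟩ := exists_isColimitOfCauchyTriangles hcD.1 hcE.1 m₁
  have lF' : m.localAt i F' := h'.localAt_obj₃ lD lE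
  obtain ⟨c, hc₂, hc₃⟩ : ∃ c : (yon S).obj (sF.obj n) ⟶ F',
      (yon S).map o₃ ≫ c = ιE.app n ≫ v' ∧
        c ≫ w' = (yon S).map (w₂.app n ≫ (v₁.app n)⟦(1 : ℤ)⟧') ≫
          (yonShift S).hom.app (sD.obj n) ≫ (ιD.app n)⟦(1 : ℤ)⟧' :=
    h'.complete_of_distTriang mem (ιD.app n) (ιE.app n) hm₁.symm
  obtain ⟨φ, hφ : ιF.app n ≫ φ = c⟩ := (bF lF').2 c
  have hφ₂ : m₃ ≫ φ = v' := (bE lF').1 (by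
    change ιE.app n ≫ m₃ ≫ φ = ιE.app n ≫ v'
    rw [reassoc_of% hm₃, hφ, hc₂])
  have hφ₃ : φ ≫ w' = w₂₃ ≫ v₁₂⟦(1 : ℤ)⟧' := (bF lD).1 (by
    change ιF.app n ≫ φ ≫ w' = ιF.app n ≫ w₂₃ ≫ v₁₂⟦(1 : ℤ)⟧'
    rw [reassoc_of% hφ, hc₃, reassoc_of% (hw₂₃ n), ← Functor.map_comp, hv₁₂, Functor.map_comp_assoc,
      Functor.map_comp (shiftFunctor (ModCat S) (1 : ℤ)), ← yonShift_naturality_assoc])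
  have := isIso_of_octahedron h₁₂ h₂₃ h₁₃ h' comm₁ comm₂ comm₃ comm₄ zero hφ₂ hφ₃
  refine ⟨D, E, F, v₁₂, w₁₂, v₂₃, w₂₃, v₁₃, w₁₃, m₁, m₃, h₁₂, h₂₃, h₁₃, comm₁, comm₂, comm₃,
    comm₄, h'.of_iso (Triangle.isoMk _ _ (Iso.refl _) (Iso.refl _) (asIso φ).symm ?_ ?_ ?_)⟩
  · exact (Category.comp_id _).trans (Category.id_comp _).symm
  · change v' ≫ inv φ = 𝟙 E ≫ m₃
    rw [IsIso.comp_inv_eq, Category.id_comp, hφ₂]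
  · change w' ≫ (𝟙 D)⟦(1 : ℤ)⟧' = inv φ ≫ w₂₃ ≫ v₁₂⟦(1 : ℤ)⟧'
    rw [IsIso.eq_inv_comp, CategoryTheory.Functor.map_id, Category.comp_id, hφ₃]

end Axioms

end TriangulatedMetric

/-! ### The triangulated structure on the completion -/

namespace TriangulatedMetric

section TriangulatedStructure

variable {S : Type u} [Category.{v} S] [Preadditive S] [HasZeroObject S] [HasShift S ℤ]
  [∀ n : ℤ, (shiftFunctor S n).Additive] [Pretriangulated S] (m : TriangulatedMetric S)

instance : HasZeroObject m.completion.FullSubcategory where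
  zero := by
    have hZ : IsZero ((yon S).obj 0) := (yon S).map_isZero (isZero_zero S)
    refine ⟨⟨_, completion_of_isZero hZ⟩, ?_⟩
    rw [IsZero.iff_id_eq_zero]
    exact m.completion.ι.map_injective (hZ.eq_of_src _ _)

/-- The distinguished triangles of `𝔖(S)`: the colimits of Cauchy sequences of triangles. -/
def completionTriangles : Set (Triangle m.completion.FullSubcategory) :=
  {T | m.IsColimitOfCauchyTriangles (m.completion.ι.mapTriangle.obj T)}

variable {m}

/-- A morphism `Z ⟶ X[1]` of `𝔖(S)` given by a morphism in `Mod-S`; the shift of `𝔖(S)` agrees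
with that of `Mod-S` only up to the isomorphism `commShiftIso`. -/
noncomputable def homShiftMk {X Z : m.completion.FullSubcategory}
    (h : Z.obj ⟶ X.obj⟦(1 : ℤ)⟧) : Z ⟶ X⟦(1 : ℤ)⟧ :=
  ObjectProperty.homMk (h ≫ (m.completion.ι.commShiftIso (1 : ℤ)).inv.app X)

lemma ι_map_homShiftMk {X Z : m.completion.FullSubcategory} (h : Z.obj ⟶ X.obj⟦(1 : ℤ)⟧) :
    m.completion.ι.map (homShiftMk h) ≫ (m.completion.ι.commShiftIso (1 : ℤ)).hom.app X = h := by
  refine (Category.assoc h _ _).trans ?_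
  rw [Iso.inv_hom_id_app]
  exact Category.comp_id h

lemma hom_shift_ext {X Z : m.completion.FullSubcategory} {f g : Z ⟶ X⟦(1 : ℤ)⟧}
    (h : m.completion.ι.map f ≫ (m.completion.ι.commShiftIso (1 : ℤ)).hom.app X =
      m.completion.ι.map g ≫ (m.completion.ι.commShiftIso (1 : ℤ)).hom.app X) : f = g :=
  m.completion.ι.map_injective ((cancel_mono _).1 h)

lemma ι_map_comp_shift {X Y Z : m.completion.FullSubcategory} (f : Z ⟶ X⟦(1 : ℤ)⟧) (g : X ⟶ Y) :
    m.completion.ι.map (f ≫ g⟦(1 : ℤ)⟧') ≫ (m.completion.ι.commShiftIso (1 : ℤ)).hom.app Y =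
      (m.completion.ι.map f ≫ (m.completion.ι.commShiftIso (1 : ℤ)).hom.app X) ≫
        (m.completion.ι.map g)⟦(1 : ℤ)⟧' := by
  rw [Functor.map_comp, Category.assoc, Category.assoc, Functor.commShiftIso_hom_naturality]

lemma mem_completionTriangles_iff {X Y Z : m.completion.FullSubcategory} (f : X ⟶ Y) (g : Y ⟶ Z)
    (h : Z ⟶ X⟦(1 : ℤ)⟧) :
    Triangle.mk f g h ∈ m.completionTriangles ↔ m.IsColimitOfCauchyTriangles
      (Triangle.mk (m.completion.ι.map f) (m.completion.ι.map g)
        (m.completion.ι.map h ≫ (m.completion.ι.commShiftIso (1 : ℤ)).hom.app X)) :=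
  Iff.rfl

lemma mk_homShiftMk_mem_completionTriangles {X Y Z : m.completion.FullSubcategory} {f : X ⟶ Y}
    {g : Y ⟶ Z} {h : Z.obj ⟶ X.obj⟦(1 : ℤ)⟧}
    (hT : m.IsColimitOfCauchyTriangles (Triangle.mk f.hom g.hom h)) :
    Triangle.mk f g (homShiftMk h) ∈ m.completionTriangles := by
  rw [mem_completionTriangles_iff, ι_map_homShiftMk]
  exact hT

variable [IsTriangulated S]

variable (m) in
/-- The pretriangulated structure on `𝔖(S)`. -/
noncomputable abbrev completionPretriangulated :
    Pretriangulated m.completion.FullSubcategory where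
  distinguishedTriangles := m.completionTriangles
  isomorphic_distinguished T₁ hT₁ T₂ e := hT₁.of_iso (m.completion.ι.mapTriangle.mapIso e.symm)
  contractible_distinguished X := by
    have h := isColimitOfCauchyTriangles_contractible X.property.1
      (m.completion.ι.map_isZero (isZero_zero m.completion.FullSubcategory))
    have h' : m.completion.ι.map (0 : (0 : m.completion.FullSubcategory) ⟶ X⟦(1 : ℤ)⟧) ≫
        (m.completion.ι.commShiftIso (1 : ℤ)).hom.app X = 0 := by
      rw [Functor.map_zero, zero_comp]
    refine (mem_completionTriangles_iff _ _ _).2 ?_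
    rw [h']
    exact h
  distinguished_cocone_triangle {X Y} f := by
    obtain ⟨Z, g, h, hT⟩ := exists_isColimitOfCauchyTriangles X.property.1 Y.property.1 f.hom
    let Z' : m.completion.FullSubcategory := ⟨Z, hT.completion_obj₃ X.property Y.property⟩
    let g' : Y ⟶ Z' := ObjectProperty.homMk g
    exact ⟨Z', g', homShiftMk h, mk_homShiftMk_mem_completionTriangles hT⟩
  rotate_distinguished_triangle T :=
    let e := m.completion.ι.mapTriangleRotateIso.app T
    ⟨fun hT => hT.rotate.of_iso e, fun hT => (hT.of_iso e.symm).of_rotate⟩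
  complete_distinguished_triangle_morphism T₁ T₂ hT₁ hT₂ a b hab := by
    obtain ⟨c, hc₂, hc₃⟩ := exists_complete hT₁ hT₂ T₂.obj₁.property T₂.obj₂.property
      (m.completion.ι.map a) (m.completion.ι.map b) (congrArg m.completion.ι.map hab)
    refine ⟨ObjectProperty.homMk c, m.completion.ι.map_injective hc₂, hom_shift_ext ?_⟩
    rw [ι_map_comp_shift]
    exact hc₃.trans (Category.assoc _ _ _).symm

lemma isTriangulated_completion :
    let _ := m.completionPretriangulated
    IsTriangulated m.completion.FullSubcategory := by
  let _ := m.completionPretriangulated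
  refine IsTriangulated.mk' fun X Y Z f g => ?_
  obtain ⟨D, E, F, v₁₂, w₁₂, v₂₃, w₂₃, v₁₃, w₁₃, m₁, m₃, h₁₂, h₂₃, h₁₃, c₁, c₂, c₃, c₄, mem⟩ :=
    exists_octahedron X.property Y.property Z.property f.hom g.hom
  let D' : m.completion.FullSubcategory := ⟨D, h₁₂.completion_obj₃ X.property Y.property⟩
  let F' : m.completion.FullSubcategory := ⟨F, h₂₃.completion_obj₃ Y.property Z.property⟩
  let E' : m.completion.FullSubcategory := ⟨E, h₁₃.completion_obj₃ X.property Z.property⟩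
  let v₁₂' : Y ⟶ D' := ObjectProperty.homMk v₁₂
  let v₂₃' : Z ⟶ F' := ObjectProperty.homMk v₂₃
  let v₁₃' : Z ⟶ E' := ObjectProperty.homMk v₁₃
  let w₁₂' : D' ⟶ X⟦(1 : ℤ)⟧ := homShiftMk w₁₂
  let w₂₃' : F' ⟶ Y⟦(1 : ℤ)⟧ := homShiftMk w₂₃
  let w₁₃' : E' ⟶ X⟦(1 : ℤ)⟧ := homShiftMk w₁₃
  let m₁' : D' ⟶ E' := ObjectProperty.homMk m₁
  let m₃' : E' ⟶ F' := ObjectProperty.homMk m₃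
  refine ⟨X, Y, Z, D', F', E', f, g, Iso.refl _, Iso.refl _, Iso.refl _,
    (Category.comp_id f).trans (Category.id_comp f).symm,
    (Category.comp_id g).trans (Category.id_comp g).symm,
    v₁₂', w₁₂', mk_homShiftMk_mem_completionTriangles h₁₂,
    v₂₃', w₂₃', mk_homShiftMk_mem_completionTriangles h₂₃,
    v₁₃', w₁₃', mk_homShiftMk_mem_completionTriangles h₁₃,
    ⟨{ m₁ := m₁'
       m₃ := m₃'
       comm₁ := m.completion.ι.map_injective c₁
       comm₂ := hom_shift_ext ?_
       comm₃ := m.completion.ι.map_injective c₃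
       comm₄ := hom_shift_ext ?_
       mem := (mem_completionTriangles_iff _ _ _).2 ?_ }⟩⟩
  · rw [Functor.map_comp, Category.assoc, ι_map_homShiftMk, ι_map_homShiftMk]
    exact c₂
  · rw [ι_map_comp_shift, ι_map_homShiftMk, Functor.map_comp, Category.assoc, ι_map_homShiftMk]
    exact c₄
  · rw [ι_map_comp_shift, ι_map_homShiftMk]
    exact mem

end TriangulatedStructure

end TriangulatedMetric

end MetricCompletion

open CategoryTheory Limits Pretriangulated MetricCompletion in
/-- The full subcategory `𝔖(S)` of `Mod-S` is stable under the shift, has a zero object, and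
carries a triangulated structure whose distinguished triangles are exactly the colimits
in `Mod-S`, with vertices in `𝔖(S)`, of Cauchy sequences of distinguished triangles of `S`. -/
theorem theorem205p13 {S : Type u} [Category.{v} S] [Preadditive S] [HasZeroObject S]
    [HasShift S ℤ] [∀ n : ℤ, (shiftFunctor S n).Additive] [Pretriangulated S]
    [IsTriangulated S] [EssentiallySmall.{v} S] (m : TriangulatedMetric S) :
    ∃ (_ : m.completion.IsStableUnderShift ℤ)
      (_ : HasZeroObject m.completion.FullSubcategory)
      (P : Pretriangulated m.completion.FullSubcategory),
      P.distinguishedTriangles =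
        {T | m.IsColimitOfCauchyTriangles (m.completion.ι.mapTriangle.obj T)} ∧
      IsTriangulated m.completion.FullSubcategory :=
  ⟨inferInstance, inferInstance, m.completionPretriangulated, rfl,
    TriangulatedMetric.isTriangulated_completion⟩
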